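/- **Setting.** Let $r_1,\dots,r_N\in(0,1)$ and let $\{S_i\}_{i=1}^N$ be similitudes of $\mathbb R^d$ with ratios $r_i$; its self-similar set is the nonempty compact $K$ with $K=\bigcup_i S_i(K)$. It is *dust-like* if $S_i(K)\cap S_j(K)=\emptyset$ for $i\ne j$. For a word $x=i_1\cdots i_k$ put $S_x=S_{i_1}\circ\cdots\circ S_{i_k}$, $r_x=r_{i_1}\cdots r_{i_k}$, and let $r=\min_i r_i$. Let $X_0=\{\vartheta\}$, where $\vartheta$ is the empty word, $X_n=\{x=i_1\cdots i_k: r_x\le r^n<r_{i_1\cdots i_{k-1}}\}$ for $n\ge 1$, and $X=\bigcup_n X_n$; write $|x|=n$ for $x\in X_n$. A vertical edge leads from $x\in X_n$ to $y\in X_{n+1}$ (an *offspring* of $x$) if $x$ is a prefix of $y$; let $\mathcal E_v$ be the set of these edges, so that $(X,\mathcal E_v)$ is a tree with root $\vartheta$. Fix $\kappa>0$. A horizontal edge joins $x\neq y$ if $|x|=|y|$ and $\operatorname{dist}(S_x(K),S_y(K))\le\kappa r^{|x|}$. Let $\mathcal E$ consist of the vertical and the horizontal edges; $(X,\mathcal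 E)$ is the *augmented tree*. The *quotient* $X^\sim$ is obtained from $X$ by identifying $x,y$ when $|x|=|y|$ and $S_x=S_y$, with the induced vertical and horizontal edges (loops discarded). The *reduced tree* $(X^\sim,\mathcal E_v^*)$ keeps, for each vertex, only the vertical edge from its lexicographically smallest parent, where a class of words is represented by its lexicographically smallest word. A *horizontal component* $T$ is a connected component with respect to the horizontal edges, and $T_{\mathcal D}$ is $T$ together with all its descendants. Components $T,T'$ are equivalent if there is a bijection $T_{\mathcal D}\to T'_{\mathcal D}$ which, with its inverse, preserves the horizontal edges and the (directed) vertical edges. The graph is *simple* if there are finitely many classes $[T_1],\dots,[T_m]$; its incidence matrix is $A=[a_{ij}]$, where $a_{ij}$ is the number of horizontal components in $[T_j]$ that consist of offspring of a given $T\in[T_i]$. Likewise two vertices of a tree ($(X,\mathcal E_v)$, or $(X^\sim,\mathcal E_v^*)$) are equivalent if their subtrees of descendants are isomorphic (with directed edges); the tree is simple if there are finitely many classes $[t_1],\dots,[t_n]$, always with the root in $[t_1]$, and its incidence matrix is $B=[b_{ij}]$, where $b_{ij}$ is the number of offspring in $[t_j]$ of a vertex in $[t_i]$. The *representation* is $\mathbf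 u=[\mathbf u_1,\dots,\mathbf u_m]$, $\mathbf u_i=[u_{i1},\dots,u_{in}]$, where each $T\in[T_i]$ has exactly $u_{ij}$ vertices in $[t_j]$. The matrix $A$ is *$(B,\mathbf u)$-rearrangeable* if for each $i$ there is a nonnegative integer $p\times m$ matrix $C=[c_{kl}]$, $p=\sum_j u_{ij}$, whose column sums form the $i$-th row of $A$ and such that for every $j$ exactly $u_{ij}$ of the $p$ vectors $\mathbf c_k=\sum_l c_{kl}\mathbf u_l$ are equal to the $j$-th row of $B$. Two metric spaces are *Lipschitz equivalent* if there is a bi-Lipschitz bijection between them. **Theorem.** Let $K$ and $K'$ be self-similar sets (in Euclidean spaces $\mathbb R^{d}$, $\mathbb R^{d'}$) of two systems of similitudes with the same ratios $r_1,\dots,r_N\in(0,1)$, and let $X,Y$ be their augmented trees (for constants $\kappa,\kappa'>0$). (i) Suppose that $X$ and $Y$ are simple, that their trees of vertical edges are simple and have a common incidence matrix $B$, and that the incidence matrices of $X$ and $Y$ are $(B,\mathbf u)$-rearrangeable and $(B,\mathbf u')$-rearrangeable respectively, where $\mathbf u,\mathbf u'$ are their representations. Then $K$ and $K'$ are Lipschitz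 equivalent to each other, and also to a dust-like self-similar set with ratios $r_1,\dots,r_N$ in some Euclidean space; indeed they are Lipschitz equivalent to every such dust-like set, in any dimension. (ii) Suppose that the same holds with $X,Y$ replaced by the quotients $X^\sim,Y^\sim$ and the trees of vertical edges replaced by the reduced trees. Then $K$ and $K'$ are Lipschitz equivalent to each other, and also to a compact metric space whose metric is an ultrametric and which is a Cantor-type set, that is, nonempty, compact, totally disconnected, and without isolated points unless it is a single point. -/

import Mathlib

noncomputable section

namespace AugTree

/-- Two metric spaces are Lipschitz equivalent if there is a bi-Lipschitz bijection. -/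
def LipEquiv (X Y : Type*) [MetricSpace X] [MetricSpace Y] : Prop :=
  ∃ (f : X ≃ Y) (C : ℝ), 0 < C ∧
    ∀ x y, C⁻¹ * dist x y ≤ dist (f x) (f y) ∧ dist (f x) (f y) ≤ C * dist x y

/-- A Cantor-type set: nonempty, compact, totally disconnected, and without isolated points
unless it is a single point. -/
structure IsCantorType (C : Type*) [MetricSpace C] : Prop where
  nonempty : Nonempty C
  compact : CompactSpace C
  totallyDisconnected : TotallyDisconnectedSpace C
  perfect : Nontrivial C → PerfectSpace C

/-- The distance `inf {|a - b| : a ∈ A, b ∈ B}` of two sets (used for nonempty sets). -/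
def setDist {E : Type*} [MetricSpace E] (A B : Set E) : ℝ := sInf (Set.image2 dist A B)

/-! ### Iterated function systems of similitudes -/

/-- An iterated function system on `ℝᵈ` that consists of similitudes with the ratios `ρ i`. -/
structure IFS (d : ℕ) {N : ℕ} (ρ : Fin N → ℝ) where
  map : Fin N → EuclideanSpace ℝ (Fin d) → EuclideanSpace ℝ (Fin d)
  dist_map : ∀ i x y, dist (map i x) (map i y) = ρ i * dist x y

/-- `K` is the self-similar set of the system: nonempty, compact, `K = ⋃ i, S_i(K)`. -/
structure IFS.IsSelfSimilarSet {d N : ℕ} {ρ : Fin N → ℝ} (S : IFS d ρ)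
    (K : Set (EuclideanSpace ℝ (Fin d))) : Prop where
  nonempty : K.Nonempty
  isCompact : IsCompact K
  eq_iUnion : K = ⋃ i, S.map i '' K

/-- Dust-like (strongly separated): the first-level pieces are pairwise disjoint. -/
def IFS.IsDustLike {d N : ℕ} {ρ : Fin N → ℝ} (S : IFS d ρ)
    (K : Set (EuclideanSpace ℝ (Fin d))) : Prop :=
  Pairwise fun i j => Disjoint (S.map i '' K) (S.map j '' K)

/-- `S_x = S_{i₁} ∘ ⋯ ∘ S_{i_k}` for a word `x = i₁ ⋯ i_k`. -/
def IFS.wordMap {d N : ℕ} {ρ : Fin N → ℝ} (S : IFS d ρ) (w : List (Fin N)) :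
    EuclideanSpace ℝ (Fin d) → EuclideanSpace ℝ (Fin d) :=
  w.foldr (fun i f => S.map i ∘ f) id

/-- `r_x = r_{i₁} ⋯ r_{i_k}`. -/
def wordRatio {N : ℕ} (ρ : Fin N → ℝ) (w : List (Fin N)) : ℝ := (w.map ρ).prod

/-- `r = min_i r_i`. -/
def minRatio {N : ℕ} (ρ : Fin N → ℝ) : ℝ := ⨅ i, ρ i

/-- `X_n`: the words `x = i₁ ⋯ i_k` with `r_x ≤ rⁿ < r_{i₁ ⋯ i_{k-1}}`; the second inequality
is void for the empty word, so that `X_0 = {∅}`. -/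
def levelWords {N : ℕ} (ρ : Fin N → ℝ) (n : ℕ) : Set (List (Fin N)) :=
  {w | wordRatio ρ w ≤ minRatio ρ ^ n ∧ (w ≠ [] → minRatio ρ ^ n < wordRatio ρ w.dropLast)}

/-- The vertex set `X = ⋃ n, X_n`. (For ratios in `(0,1)` the levels `X_n` are disjoint.) -/
@[ext] structure Vertex {N : ℕ} (ρ : Fin N → ℝ) where
  level : ℕ
  word : List (Fin N)
  mem : word ∈ levelWords ρ level

/-- The root `ϑ`, the empty word. -/
def root {N : ℕ} (ρ : Fin N → ℝ) : Vertex ρ :=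
  ⟨0, [], by simp [levelWords, wordRatio]⟩

/-- The vertical edges, directed from a vertex `x` to its offspring `y`. -/
def Vert {N : ℕ} {ρ : Fin N → ℝ} (x y : Vertex ρ) : Prop :=
  y.level = x.level + 1 ∧ x.word <+: y.word

/-- The horizontal edges: `|x| = |y|`, `x ≠ y`, `dist(S_x(K), S_y(K)) ≤ κ r^|x|`. -/
def IFS.hor {d N : ℕ} {ρ : Fin N → ℝ} (S : IFS d ρ) (K : Set (EuclideanSpace ℝ (Fin d)))
    (κ : ℝ) : SimpleGraph (Vertex ρ) where
  Adj x y := x ≠ y ∧ x.level = y.level ∧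
    setDist (S.wordMap x.word '' K) (S.wordMap y.word '' K) ≤ κ * minRatio ρ ^ x.level
  symm := ⟨by
    rintro x y ⟨h1, h2, h3⟩
    refine ⟨h1.symm, h2.symm, ?_⟩
    rw [← h2]
    refine le_of_eq_of_le ?_ h3
    unfold setDist
    rw [Set.image2_swap]
    simp only [dist_comm]⟩
  loopless := ⟨fun _ h => h.1 rfl⟩

/-! ### The quotient by `|x| = |y|`, `S_x = S_y` -/

/-- The identification of `x` and `y` when `|x| = |y|` and `S_x = S_y`. -/
def IFS.vertexSetoid {d N : ℕ} {ρ : Fin N → ℝ} (S : IFS d ρ) : Setoid (Vertex ρ) where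
  r x y := x.level = y.level ∧ S.wordMap x.word = S.wordMap y.word
  iseqv := ⟨fun _ => ⟨rfl, rfl⟩, fun h => ⟨h.1.symm, h.2.symm⟩,
    fun h h' => ⟨h.1.trans h'.1, h.2.trans h'.2⟩⟩

/-- The quotient space `X^∼`. -/
def IFS.QVertex {d N : ℕ} {ρ : Fin N → ℝ} (S : IFS d ρ) : Type := Quotient S.vertexSetoid

/-- The class of a vertex in `X^∼`. -/
def IFS.toQ {d N : ℕ} {ρ : Fin N → ℝ} (S : IFS d ρ) (x : Vertex ρ) : S.QVertex :=
  Quotient.mk S.vertexSetoid x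

/-- The vertical edges induced on `X^∼`, directed from a parent to its offspring. -/
def IFS.QVert {d N : ℕ} {ρ : Fin N → ℝ} (S : IFS d ρ) (p q : S.QVertex) : Prop :=
  ∃ x y, S.toQ x = p ∧ S.toQ y = q ∧ Vert x y

/-- The horizontal edges induced on `X^∼`. -/
def IFS.qhor {d N : ℕ} {ρ : Fin N → ℝ} (S : IFS d ρ) (K : Set (EuclideanSpace ℝ (Fin d)))
    (κ : ℝ) : SimpleGraph S.QVertex where
  Adj p q := p ≠ q ∧ ∃ x y, S.toQ x = p ∧ S.toQ y = q ∧ (S.hor K κ).Adj x y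
  symm := ⟨by
    rintro p q ⟨h, x, y, hx, hy, hxy⟩
    exact ⟨h.symm, y, x, hy, hx, hxy.symm⟩⟩
  loopless := ⟨fun _ h => h.1 rfl⟩

/-- The lexicographic order of `X^∼`: the (finitely many) words of a class are represented by
the least one, so `p` precedes `q` if some word of `p` is at most every word of `q`. -/
def IFS.LexLE {d N : ℕ} {ρ : Fin N → ℝ} (S : IFS d ρ) (p q : S.QVertex) : Prop :=
  ∃ x, S.toQ x = p ∧ ∀ y, S.toQ y = q → x.word ≤ y.word

/-- The edges of the reduced tree on `X^∼`: of all the edges from the parents of `q` to `q` only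
that from the lexicographically smallest parent is kept. -/
def IFS.RedVert {d N : ℕ} {ρ : Fin N → ℝ} (S : IFS d ρ) (p q : S.QVertex) : Prop :=
  S.QVert p q ∧ ∀ p', S.QVert p' q → S.LexLE p p'

/-! ### Equivalence classes, incidence matrices, rearrangeability

Below `vert` are the vertical edges (directed from parent to offspring), `H` the horizontal edges
of a graph on `V`, and the horizontal components are the connected components of `H`. -/

/-- `T` together with all its descendants. -/
def descendants {V : Type*} (vert : V → V → Prop) (T : Set V) : Set V :=
  {y | ∃ x ∈ T, Relation.ReflTransGen vert x y}

/-- Equivalence of horizontal components `T`, `T'`: an isomorphism of the graphs on `T` and `T'`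
with all their descendants, which preserves the (directed) vertical and the horizontal edges. -/
def CompEquiv {V : Type*} (vert : V → V → Prop) (H : SimpleGraph V)
    (T T' : H.ConnectedComponent) : Prop :=
  ∃ g : descendants vert T.supp ≃ descendants vert T'.supp,
    (∀ x y, vert x.1 y.1 ↔ vert (g x).1 (g y).1) ∧
    (∀ x y, H.Adj x.1 y.1 ↔ H.Adj (g x).1 (g y).1)

/-- Equivalence of vertices of a tree: an isomorphism of the subtrees of descendants. -/
def VertexEquiv {V : Type*} (tree : V → V → Prop) (x y : V) : Prop :=
  ∃ g : descendants tree {x} ≃ descendants tree {y},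
    ∀ a b, tree a.1 b.1 ↔ tree (g a).1 (g b).1

/-- The horizontal component `Z` consists of offspring of `T`. -/
def IsOffspring {V : Type*} (vert : V → V → Prop) (H : SimpleGraph V)
    (T Z : H.ConnectedComponent) : Prop :=
  ∀ y ∈ Z.supp, ∃ x ∈ T.supp, vert x y

/-- The graph is simple: `cls` enumerates the equivalence classes of horizontal components as
`[T_1], …, [T_m]`; and `A` is its incidence matrix. -/
structure IsCompIncidence {V : Type*} (vert : V → V → Prop) (H : SimpleGraph V) {m : ℕ}
    (cls : H.ConnectedComponent → Fin m) (A : Matrix (Fin m) (Fin m) ℕ) : Prop where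
  surjective : Function.Surjective cls
  eq_iff : ∀ T T', cls T = cls T' ↔ CompEquiv vert H T T'
  card_eq : ∀ T j, Nat.card {Z // IsOffspring vert H T Z ∧ cls Z = j} = A (cls T) j

/-- The tree is simple: `typ` enumerates the equivalence classes of vertices as
`[t_1], …, [t_n]`, with the root in `[t_1]`; and `B` is its incidence matrix. -/
structure IsTreeIncidence {V : Type*} (tree : V → V → Prop) (root : V) {n : ℕ} [NeZero n]
    (typ : V → Fin n) (B : Matrix (Fin n) (Fin n) ℕ) : Prop where
  surjective : Function.Surjective typ
  eq_iff : ∀ x y, typ x = typ y ↔ VertexEquiv tree x y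
  root_eq : typ root = 0
  card_eq : ∀ x j, Nat.card {y // tree x y ∧ typ y = j} = B (typ x) j

/-- `u` represents the classes of components by the classes of vertices: each component of the
`i`-th class has `u i j` vertices in the `j`-th class. -/
def IsRepresentation {V : Type*} (H : SimpleGraph V) {m n : ℕ}
    (cls : H.ConnectedComponent → Fin m) (typ : V → Fin n) (u : Matrix (Fin m) (Fin n) ℕ) : Prop :=
  ∀ T j, Nat.card {x // x ∈ T.supp ∧ typ x = j} = u (cls T) j

/-- `A` is `(B, u)`-rearrangeable. The rows of `u` are the blocks `u_1, …, u_m`. -/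
def IsRearrangeable {m n : ℕ} (A : Matrix (Fin m) (Fin m) ℕ) (B : Matrix (Fin n) (Fin n) ℕ)
    (u : Matrix (Fin m) (Fin n) ℕ) : Prop :=
  ∀ i, ∃ C : Matrix (Fin (∑ j, u i j)) (Fin m) ℕ,
    A i = Matrix.vecMul 1 C ∧ ∀ j, Nat.card {k // (C * u) k = B j} = u i j

/-- The graph with vertical edges `vert` and horizontal edges `H` is simple, the tree with edges
`tree` is simple with incidence matrix `B`, and the incidence matrix of the graph is
`(B, u)`-rearrangeable, where `u` is the representation of the classes of components. -/
def IsSimpleRearrangeable {V : Type*} (vert : V → V → Prop) (H : SimpleGraph V)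
    (tree : V → V → Prop) (root : V) {n : ℕ} [NeZero n] (B : Matrix (Fin n) (Fin n) ℕ) : Prop :=
  ∃ (m : ℕ) (A : Matrix (Fin m) (Fin m) ℕ) (u : Matrix (Fin m) (Fin n) ℕ)
    (cls : H.ConnectedComponent → Fin m) (typ : V → Fin n),
    IsCompIncidence vert H cls A ∧ IsTreeIncidence tree root typ B ∧
      IsRepresentation H cls typ u ∧ IsRearrangeable A B u

/-- The hypothesis on the augmented tree `(X, E)` and its tree `(X, E_v)`. -/
def IFS.AugmentedHyp {d N : ℕ} {ρ : Fin N → ℝ} (S : IFS d ρ)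
    (K : Set (EuclideanSpace ℝ (Fin d))) (κ : ℝ) {n : ℕ} [NeZero n]
    (B : Matrix (Fin n) (Fin n) ℕ) : Prop :=
  IsSimpleRearrangeable Vert (S.hor K κ) Vert (root ρ) B

/-- The hypothesis on the quotient `(X^∼, E)` and its reduced tree `(X^∼, E_v^*)`. -/
def IFS.QuotientHyp {d N : ℕ} {ρ : Fin N → ℝ} (S : IFS d ρ)
    (K : Set (EuclideanSpace ℝ (Fin d))) (κ : ℝ) {n : ℕ} [NeZero n]
    (B : Matrix (Fin n) (Fin n) ℕ) : Prop :=
  IsSimpleRearrangeable S.QVert (S.qhor K κ) S.RedVert (S.toQ (root ρ)) B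

end AugTree

end

namespace AugTree

/-! ### Lipschitz equivalence -/

/-! The self-similar set is turned into the boundary of a tree on the same vertices, whose edges are
rearranged so that the tree sees the horizontal components. Let a vertex `y` of positive level get a
new parent `q y` that depends only on the horizontal component of `y` and lies in the component
formed by the old parents. A point of `K` determines a component on each level, since pieces with a
common point are joined. Applying `q` to these components codes the point by an infinite path.
Agreement of two codes at time `k` puts the points into one component of level `k`. There are
finitely many classes of components, so their sizes are bounded, and the distance is at most a
constant times `r ^ k`. Disagreement at time `k` means different components on level `k + 1`, hence
pieces without a horizontal edge and a distance above `κ * r ^ (k + 1)`. So `K` is bi-Lipschitz to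
the boundary (`IsPieceSystem.lipEquiv_boundary`).

Rearrangeability lets `q` be chosen so that the new tree still has incidence matrix `B` for the old
vertex types (`exists_rearrangedParent`): the offspring components of `T` are distributed over the
vertices of `T`, and a vertex of type `j` receives exactly the numbers of vertices in the `j`-th row
of `B`. For this the type must be readable from the row. It is, because in a tree equal rows force
isomorphic subtrees (`IsTreeIncidence.injective`).

Typed trees with the same matrix and root type have isometric boundaries
(`lipEquiv_boundary_of_incidence`), which compares `K` with `K'`. In (i) the tree of words itself
has matrix `B`, and its boundary is a model of every dust-like set with these ratios. In (ii) the
boundary of the rearranged tree serves as the ultrametric space. -/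

theorem LipEquiv.symm {X Y : Type*} [MetricSpace X] [MetricSpace Y] (h : LipEquiv X Y) :
    LipEquiv Y X := by
  obtain ⟨f, C, hC, h⟩ := h
  refine ⟨f.symm, C, hC, fun x y => ?_⟩
  have := h (f.symm x) (f.symm y)
  simp only [Equiv.apply_symm_apply] at this
  exact ⟨(inv_mul_le_iff₀ hC).2 this.2, (inv_mul_le_iff₀ hC).1 this.1⟩

theorem LipEquiv.trans {X Y Z : Type*} [MetricSpace X] [MetricSpace Y] [MetricSpace Z]
    (h : LipEquiv X Y) (h' : LipEquiv Y Z) : LipEquiv X Z := by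
  obtain ⟨f, C, hC, h⟩ := h
  obtain ⟨g, C', hC', h'⟩ := h'
  refine ⟨f.trans g, C' * C, mul_pos hC' hC, fun x y => ⟨?_, ?_⟩⟩
  · rw [mul_inv, mul_assoc]
    exact (mul_le_mul_of_nonneg_left (h x y).1 (inv_nonneg.2 hC'.le)).trans (h' (f x) (f y)).1
  · rw [mul_assoc]
    exact (h' (f x) (f y)).2.trans (mul_le_mul_of_nonneg_left (h x y).2 hC'.le)

/-! ### The space of infinite paths -/

/-- The infinite paths from `root` along the edges `E`, with the metric `s ^ k`, where `k` is the
first time at which two paths differ. -/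
@[ext] structure Boundary {V : Type*} (E : V → V → Prop) (root : V) (s : Set.Ioo (0 : ℝ) 1) where
  path : ℕ → V
  zero : path 0 = root
  edge : ∀ k, E (path k) (path (k + 1))

namespace Boundary

variable {V : Type*} {E : V → V → Prop} {root : V} {s : Set.Ioo (0 : ℝ) 1}

/-- The first time at which two paths differ. -/
noncomputable def split (p q : Boundary E root s) : ℕ :=
  PiNat.firstDiff (E := fun _ => V) p.path q.path

theorem path_split_ne {p q : Boundary E root s} (h : p ≠ q) :
    p.path (split p q) ≠ q.path (split p q) :=
  PiNat.apply_firstDiff_ne (E := fun _ => V) fun h' => h (Boundary.ext h')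

theorem path_eq_of_lt_split {p q : Boundary E root s} {k : ℕ} (h : k < split p q) :
    p.path k = q.path k :=
  PiNat.apply_eq_of_lt_firstDiff (E := fun _ => V) h

theorem split_pos {p q : Boundary E root s} (h : p ≠ q) : 0 < split p q := by
  refine Nat.pos_of_ne_zero fun h0 => path_split_ne h ?_
  rw [h0, p.zero, q.zero]

theorem le_split {p q : Boundary E root s} (h : p ≠ q) {k : ℕ}
    (hk : ∀ l < k, p.path l = q.path l) : k ≤ split p q :=
  not_lt.1 fun h' => path_split_ne h (hk _ h')

open Classical in
noncomputable instance : Dist (Boundary E root s) :=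
  ⟨fun p q => if p = q then 0 else (s : ℝ) ^ split p q⟩

theorem dist_of_ne {p q : Boundary E root s} (h : p ≠ q) : dist p q = (s : ℝ) ^ split p q :=
  if_neg h

theorem dist_eq_zero_self (p : Boundary E root s) : dist p p = 0 := if_pos rfl

theorem dist_nonneg' (p q : Boundary E root s) : 0 ≤ dist p q := by
  by_cases h : p = q
  · rw [h, dist_eq_zero_self]
  · rw [dist_of_ne h]
    exact pow_nonneg s.2.1.le _

theorem dist_le_max (p q t : Boundary E root s) : dist p t ≤ max (dist p q) (dist q t) := by
  by_cases hpt : p = t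
  · rw [hpt, dist_eq_zero_self]
    exact le_max_of_le_left (dist_nonneg' _ _)
  by_cases hpq : p = q
  · rw [hpq]
    exact le_max_right _ _
  by_cases hqt : q = t
  · rw [hqt]
    exact le_max_left _ _
  rw [dist_of_ne hpt, dist_of_ne hpq, dist_of_ne hqt]
  have := PiNat.min_firstDiff_le (E := fun _ => V) p.path q.path t.path
    fun h => hpt (Boundary.ext h)
  rcases min_le_iff.1 this with h | h
  · exact le_max_of_le_left (pow_le_pow_of_le_one s.2.1.le s.2.2.le h)
  · exact le_max_of_le_right (pow_le_pow_of_le_one s.2.1.le s.2.2.le h)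

noncomputable instance : MetricSpace (Boundary E root s) where
  dist_self := dist_eq_zero_self
  dist_comm p q := by
    by_cases h : p = q
    · rw [h]
    · rw [dist_of_ne h, dist_of_ne (Ne.symm h), split, PiNat.firstDiff_comm]
      rfl
  dist_triangle p q t := (dist_le_max p q t).trans
    (max_le_add_of_nonneg (dist_nonneg' _ _) (dist_nonneg' _ _))
  eq_of_dist_eq_zero {p q} h := by
    by_contra hne
    rw [dist_of_ne hne] at h
    exact (pow_pos s.2.1 _).ne' h

instance : IsUltrametricDist (Boundary E root s) := ⟨dist_le_max⟩

/-- A map of paths which preserves initial agreement is nonexpanding. -/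
theorem dist_map_le {V' : Type*} {E' : V' → V' → Prop} {root' : V'}
    {F : Boundary E root s → Boundary E' root' s}
    (hF : ∀ p q k, (∀ l < k, p.path l = q.path l) → ∀ l < k, (F p).path l = (F q).path l)
    (p q : Boundary E root s) : dist (F p) (F q) ≤ dist p q := by
  by_cases h : F p = F q
  · rw [h, dist_self]
    exact dist_nonneg
  have hpq : p ≠ q := fun h' => h (by rw [h'])
  rw [dist_of_ne h, dist_of_ne hpq]
  exact pow_le_pow_of_le_one s.2.1.le s.2.2.le
    (le_split h (hF p q _ fun l hl => path_eq_of_lt_split hl))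

end Boundary

/-- A metric space which is coded by the paths of `E` in such a way that agreement up to time `k`
means a distance of order at most `s ^ k`. -/
theorem lipEquiv_boundary_of_code {Z V : Type*} [MetricSpace Z] {E : V → V → Prop} {root : V}
    {s : Set.Ioo (0 : ℝ) 1} (f : Z → Boundary E root s) (hf : Function.Surjective f) {c C : ℝ}
    (hc : 0 < c) (hC : ∀ x y k, (f x).path k = (f y).path k → dist x y ≤ C * (s : ℝ) ^ k)
    (hc' : ∀ x y k, (f x).path k ≠ (f y).path k → c * (s : ℝ) ^ k ≤ dist x y) :
    LipEquiv Z (Boundary E root s) := by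
  have hs := s.2
  have hinj : Function.Injective f := by
    intro x y hxy
    have h0 : Filter.Tendsto (fun k : ℕ => C * (s : ℝ) ^ k) Filter.atTop (nhds (C * 0)) :=
      (tendsto_pow_atTop_nhds_zero_of_lt_one hs.1.le hs.2).const_mul C
    rw [mul_zero] at h0
    exact dist_le_zero.1 (ge_of_tendsto' h0 fun k => hC x y k (by rw [hxy]))
  -- The paths agree only up to time `split - 1`, so the upper bound loses one factor `s`; this
  -- gives `C / s`. The other bound is used at time `split` itself and gives `c⁻¹`.
  have hK : 0 < max (C / s) c⁻¹ := lt_max_of_lt_right (inv_pos.2 hc)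
  refine ⟨Equiv.ofBijective f ⟨hinj, hf⟩, max (C / s) c⁻¹, hK, fun x y => ?_⟩
  change _ * dist x y ≤ dist (f x) (f y) ∧ dist (f x) (f y) ≤ _ * dist x y
  by_cases hxy : x = y
  · rw [hxy, dist_self, dist_self, mul_zero, mul_zero]
    exact ⟨le_rfl, le_rfl⟩
  have hne : f x ≠ f y := fun h => hxy (hinj h)
  have hp : 0 < (s : ℝ) ^ (f x).split (f y) := pow_pos hs.1 _
  rw [Boundary.dist_of_ne hne, inv_mul_le_iff₀ hK]
  constructor
  · obtain ⟨k, hk⟩ := Nat.exists_eq_succ_of_ne_zero (Boundary.split_pos hne).ne'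
    refine (hC x y k (Boundary.path_eq_of_lt_split (by omega))).trans ?_
    have : C * (s : ℝ) ^ k = C / s * (s : ℝ) ^ (f x).split (f y) := by
      rw [hk, Nat.succ_eq_add_one, pow_succ]
      field_simp [hs.1.ne']
    rw [this]
    exact mul_le_mul_of_nonneg_right (le_max_left _ _) hp.le
  · have h1 := hc' x y _ (Boundary.path_split_ne hne)
    calc (s : ℝ) ^ (f x).split (f y) = c⁻¹ * (c * (s : ℝ) ^ (f x).split (f y)) := by
          field_simp
      _ ≤ c⁻¹ * dist x y := mul_le_mul_of_nonneg_left h1 (inv_nonneg.2 hc.le)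
      _ ≤ _ := mul_le_mul_of_nonneg_right (le_max_right _ _) dist_nonneg

/-! ### Trees with the same incidence matrix -/

theorem exists_equiv_of_card_fiber {α β ι : Type*} [Finite α] [Finite β] (f : α → ι) (g : β → ι)
    (h : ∀ i, Nat.card {a // f a = i} = Nat.card {b // g b = i}) :
    ∃ e : α ≃ β, ∀ a, g (e a) = f a := by
  have e : ∀ i, Nonempty ({a // f a = i} ≃ {b // g b = i}) := fun i => Finite.card_eq.1 (h i)
  exact ⟨Equiv.ofFiberEquiv fun i => (e i).some, fun a => Equiv.ofFiberEquiv_map _ a⟩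

theorem card_fiber_subtype {V ι : Type*} (P : V → Prop) (typ : V → ι) (j : ι) :
    Nat.card {a : {y // P y} // typ a = j} = Nat.card {y // P y ∧ typ y = j} :=
  Nat.card_congr (Equiv.subtypeSubtypeEquivSubtypeInter P fun y => typ y = j)

/-- Equal rows mean equally many offspring of each type, so the offspring can be matched type by
type. Only the rows have to agree, not the types of the parents; this is what shows that the rows of
`B` are distinct. -/
theorem exists_children_equiv {V V' ι : Type*} {E : V → V → Prop} {E' : V' → V' → Prop}
    {typ : V → ι} {typ' : V' → ι} {B : ι → ι → ℕ}
    (hfin : ∀ x, Finite {y // E x y}) (hfin' : ∀ x, Finite {y // E' x y})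
    (hB : ∀ x j, Nat.card {y // E x y ∧ typ y = j} = B (typ x) j)
    (hB' : ∀ x j, Nat.card {y // E' x y ∧ typ' y = j} = B (typ' x) j)
    {x : V} {x' : V'} (h : B (typ x) = B (typ' x')) :
    ∃ e : {y // E x y} ≃ {y // E' x' y}, ∀ y, typ' (e y) = typ y :=
  exists_equiv_of_card_fiber (fun y : {y // E x y} => typ y) (fun y : {y // E' x' y} => typ' y)
    fun i => by rw [card_fiber_subtype, card_fiber_subtype, hB, hB', h]

/-- The image path is built recursively. The formula for its next vertex is kept because it reduces
agreement of images and inversion to inductions on time. -/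
theorem exists_transport {V V' ι : Type*} {E : V → V → Prop} {E' : V' → V' → Prop} {root : V}
    {root' : V'} {s : Set.Ioo (0 : ℝ) 1} {typ : V → ι} {typ' : V' → ι}
    (hroot : typ root = typ' root') {e : V → V' → V → V'}
    (he : ∀ x x' y, typ x = typ' x' → E x y → E' x' (e x x' y) ∧ typ y = typ' (e x x' y))
    (p : Boundary E root s) :
    ∃ p' : Boundary E' root' s, ∀ k, typ (p.path k) = typ' (p'.path k) ∧
      p'.path (k + 1) = e (p.path k) (p'.path k) (p.path (k + 1)) := by
  let f : ℕ → V' := fun k => Nat.rec root' (fun k x' => e (p.path k) x' (p.path (k + 1))) k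
  have hf : ∀ k, typ (p.path k) = typ' (f k) := by
    intro k
    induction k with
    | zero => rw [p.zero]; exact hroot
    | succ k ih => exact (he _ _ _ ih (p.edge k)).2
  exact ⟨⟨f, rfl, fun k => (he _ _ _ (hf k) (p.edge k)).1⟩, fun k => ⟨hf k, rfl⟩⟩

/-- Typed trees with the same incidence matrix have isometric boundaries. -/
theorem lipEquiv_boundary_of_incidence {V V' ι : Type*} {E : V → V → Prop} {E' : V' → V' → Prop}
    {root : V} {root' : V'} {s : Set.Ioo (0 : ℝ) 1} {typ : V → ι} {typ' : V' → ι} {B : ι → ι → ℕ}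
    (hfin : ∀ x, Finite {y // E x y}) (hfin' : ∀ x, Finite {y // E' x y})
    (hB : ∀ x j, Nat.card {y // E x y ∧ typ y = j} = B (typ x) j)
    (hB' : ∀ x j, Nat.card {y // E' x y ∧ typ' y = j} = B (typ' x) j)
    (hroot : typ root = typ' root') :
    LipEquiv (Boundary E root s) (Boundary E' root' s) := by
  classical
  choose ε hε using fun (x : V) (x' : V') (h : typ x = typ' x') =>
    exists_children_equiv hfin hfin' hB hB' (x := x) (x' := x') (by rw [h])
  -- The matchings of offspring are made total, with the roots as values that are never reached
  -- along a path.
  let e : V → V' → V → V' := fun x x' y =>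
    if h : typ x = typ' x' ∧ E x y then (ε x x' h.1 ⟨y, h.2⟩).1 else root'
  let e' : V' → V → V' → V := fun x' x y' =>
    if h : typ x = typ' x' ∧ E' x' y' then ((ε x x' h.1).symm ⟨y', h.2⟩).1 else root
  have e_of : ∀ x x' y (h : typ x = typ' x') (h' : E x y), e x x' y = (ε x x' h ⟨y, h'⟩).1 :=
    fun x x' y h h' => dif_pos ⟨h, h'⟩
  have e'_of : ∀ x' x y' (h : typ x = typ' x') (h' : E' x' y'),
      e' x' x y' = ((ε x x' h).symm ⟨y', h'⟩).1 := fun x' x y' h h' => dif_pos ⟨h, h'⟩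
  have he : ∀ x x' y, typ x = typ' x' → E x y → E' x' (e x x' y) ∧ typ y = typ' (e x x' y) := by
    intro x x' y h h'
    rw [e_of x x' y h h']
    exact ⟨(ε x x' h ⟨y, h'⟩).2, (hε x x' h ⟨y, h'⟩).symm⟩
  have he' : ∀ x' x y', typ' x' = typ x → E' x' y' →
      E x (e' x' x y') ∧ typ' y' = typ (e' x' x y') := by
    intro x' x y' h h'
    rw [e'_of x' x y' h.symm h']
    refine ⟨((ε x x' h.symm).symm ⟨y', h'⟩).2, ?_⟩
    rw [← hε x x' h.symm, Equiv.apply_symm_apply]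
  have hee' : ∀ x x' y, typ x = typ' x' → E x y → e' x' x (e x x' y) = y := by
    intro x x' y h h'
    rw [e'_of x' x _ h (he x x' y h h').1]
    simp only [e_of x x' y h h', Subtype.coe_eta, Equiv.symm_apply_apply]
  have he'e : ∀ x x' y', typ x = typ' x' → E' x' y' → e x x' (e' x' x y') = y' := by
    intro x x' y h h'
    rw [e_of x x' _ h (he' x' x y h.symm h').1]
    simp only [e'_of x' x y h h', Subtype.coe_eta, Equiv.apply_symm_apply]
  choose F hF using exists_transport (s := s) hroot he
  choose G hG using exists_transport (s := s) hroot.symm he'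
  have hFa : ∀ p q k, (∀ l < k, p.path l = q.path l) → ∀ l < k, (F p).path l = (F q).path l := by
    intro p q k h l hl
    induction l with
    | zero => rw [(F p).zero, (F q).zero]
    | succ l ih => rw [(hF p l).2, (hF q l).2, h l (by omega), h _ hl, ih (by omega)]
  have hGa : ∀ p q k, (∀ l < k, p.path l = q.path l) → ∀ l < k, (G p).path l = (G q).path l := by
    intro p q k h l hl
    induction l with
    | zero => rw [(G p).zero, (G q).zero]
    | succ l ih => rw [(hG p l).2, (hG q l).2, h l (by omega), h _ hl, ih (by omega)]
  have hGF : ∀ p, G (F p) = p := by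
    intro p
    refine Boundary.ext (funext fun k => ?_)
    induction k with
    | zero => rw [(G (F p)).zero, p.zero]
    | succ k ih => rw [(hG (F p) k).2, ih, (hF p k).2, hee' _ _ _ (hF p k).1 (p.edge k)]
  have hFG : ∀ p, F (G p) = p := by
    intro p
    refine Boundary.ext (funext fun k => ?_)
    induction k with
    | zero => rw [(F (G p)).zero, p.zero]
    | succ k ih => rw [(hF (G p) k).2, ih, (hG p k).2, he'e _ _ _ (hG p k).1.symm (p.edge k)]
  refine ⟨⟨F, G, hGF, hFG⟩, 1, one_pos, fun p q => ?_⟩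
  simp only [inv_one, one_mul, Equiv.coe_fn_mk]
  refine ⟨?_, Boundary.dist_map_le hFa p q⟩
  have := Boundary.dist_map_le hGa (F p) (F q)
  rwa [hGF, hGF] at this

end AugTree

namespace AugTree

/-! ### Vertices with the same numbers of offspring are equivalent -/

section Tree

variable {V : Type*} {tree : V → V → Prop} {lev : V → ℕ}

theorem le_lev_of_reflTransGen (hlev : ∀ x y, tree x y → lev y = lev x + 1) {x y : V}
    (h : Relation.ReflTransGen tree x y) : lev x ≤ lev y := by
  induction h with
  | refl => exact le_rfl
  | tail _ h ih => have := hlev _ _ h; omega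

/-- With unique parents, a vertex has only one ancestor on each level. -/
theorem eq_of_reflTransGen_of_lev_eq (hlev : ∀ x y, tree x y → lev y = lev x + 1)
    (huniq : ∀ x x' y, tree x y → tree x' y → x = x') {a b z : V}
    (ha : Relation.ReflTransGen tree a z) (hb : Relation.ReflTransGen tree b z)
    (hab : lev a = lev b) : a = b := by
  induction ha with
  | refl =>
    rcases Relation.ReflTransGen.cases_tail hb with h | ⟨c, h, h'⟩
    · exact h
    · have := le_lev_of_reflTransGen hlev h
      have := hlev _ _ h'
      omega
  | tail hac h ih =>
    rcases Relation.ReflTransGen.cases_tail hb with rfl | ⟨c, hbc, h'⟩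
    · have := le_lev_of_reflTransGen hlev hac
      have := hlev _ _ h
      omega
    · rw [huniq _ _ _ h' h] at hbc
      exact ih hbc

theorem mem_descendants_singleton {x z : V} :
    z ∈ descendants tree {x} ↔ Relation.ReflTransGen tree x z := by
  simp [descendants]

/-- The descendants of `x`: `x` itself and the descendants of the offspring of `x`. -/
def ofChildren (tree : V → V → Prop) (x : V) :
    Option (Σ c : {c // tree x c}, descendants tree {c.1}) → descendants tree {x}
  | none => ⟨x, mem_descendants_singleton.2 .refl⟩
  | some ⟨c, z⟩ => ⟨z.1, mem_descendants_singleton.2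
      ((mem_descendants_singleton.1 z.2).head c.2)⟩

theorem ofChildren_bijective (hlev : ∀ x y, tree x y → lev y = lev x + 1)
    (huniq : ∀ x x' y, tree x y → tree x' y → x = x') (x : V) :
    Function.Bijective (ofChildren tree x) := by
  have key : ∀ (c : {c // tree x c}) (z : descendants tree {c.1}), z.1 ≠ x := by
    intro c z h
    have := le_lev_of_reflTransGen hlev (mem_descendants_singleton.1 z.2)
    have := hlev _ _ c.2
    rw [h] at *
    omega
  constructor
  · rintro (_ | ⟨c, z⟩) (_ | ⟨c', z'⟩) h
    · rfl
    · exact absurd (congrArg Subtype.val h).symm (key c' z')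
    · exact absurd (congrArg Subtype.val h) (key c z)
    · have h' : z.1 = z'.1 := congrArg Subtype.val h
      have hz := mem_descendants_singleton.1 z.2
      have hz' := mem_descendants_singleton.1 z'.2
      rw [← h'] at hz'
      have hc : c = c' := Subtype.ext (eq_of_reflTransGen_of_lev_eq hlev huniq hz hz'
        (by rw [hlev _ _ c.2, hlev _ _ c'.2]))
      subst hc
      rw [Subtype.ext h']
  · rintro ⟨z, hz⟩
    rcases Relation.ReflTransGen.cases_head (mem_descendants_singleton.1 hz) with h | ⟨c, hc, h⟩
    · exact ⟨none, Subtype.ext h⟩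
    · exact ⟨some ⟨⟨c, hc⟩, ⟨z, mem_descendants_singleton.2 h⟩⟩, rfl⟩

theorem tree_ofChildren_iff (hlev : ∀ x y, tree x y → lev y = lev x + 1)
    (huniq : ∀ x x' y, tree x y → tree x' y → x = x') (x : V)
    (o o' : Option (Σ c : {c // tree x c}, descendants tree {c.1})) :
    tree (ofChildren tree x o).1 (ofChildren tree x o').1 ↔
      match o, o' with
      | none, some ⟨c, z⟩ => z.1 = c.1
      | some ⟨c, z⟩, some ⟨c', z'⟩ => c = c' ∧ tree z.1 z'.1
      | _, none => False := by
  have key : ∀ z, z ∈ descendants tree {x} → ¬ tree z x := by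
    intro z hz h
    have := le_lev_of_reflTransGen hlev (mem_descendants_singleton.1 hz)
    have := hlev _ _ h
    omega
  rcases o with _ | ⟨c, z⟩ <;> rcases o' with _ | ⟨c', z'⟩
  · exact iff_of_false (key _ (ofChildren tree x none).2) id
  · change tree x z'.1 ↔ z'.1 = c'.1
    have hz' := mem_descendants_singleton.1 z'.2
    refine ⟨fun h => (eq_of_reflTransGen_of_lev_eq hlev huniq .refl hz' ?_), fun h => by rw [h]; exact c'.2⟩
    rw [hlev _ _ h, hlev _ _ c'.2]
  · exact iff_of_false (key _ (ofChildren tree x (some ⟨c, z⟩)).2) id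
  · change tree z.1 z'.1 ↔ c = c' ∧ tree z.1 z'.1
    refine ⟨fun h => ⟨Subtype.ext ?_, h⟩, And.right⟩
    have hz := (mem_descendants_singleton.1 z.2).tail h
    exact eq_of_reflTransGen_of_lev_eq hlev huniq hz (mem_descendants_singleton.1 z'.2)
      (by rw [hlev _ _ c.2, hlev _ _ c'.2])

/-- An isomorphism of the trees of descendants maps the top vertex to the top vertex. -/
theorem map_top_iff (hlev : ∀ x y, tree x y → lev y = lev x + 1) {x y : V}
    (g : descendants tree {x} ≃ descendants tree {y})
    (hg : ∀ a b, tree a.1 b.1 ↔ tree (g a).1 (g b).1) (z : descendants tree {x}) :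
    (g z).1 = y ↔ z.1 = x := by
  have top : ∀ (x : V) (z : descendants tree {x}),
      z.1 = x ↔ ∀ w : descendants tree {x}, ¬ tree w.1 z.1 := by
    intro x z
    constructor
    · intro h w hw
      have := le_lev_of_reflTransGen hlev (mem_descendants_singleton.1 w.2)
      have := hlev _ _ hw
      rw [h] at this
      omega
    · intro h
      rcases Relation.ReflTransGen.cases_tail (mem_descendants_singleton.1 z.2) with h' | ⟨c, hc, h'⟩
      · exact h'
      · exact absurd h' (h ⟨c, mem_descendants_singleton.2 hc⟩)
  rw [top, top]
  exact ⟨fun h w hw => h (g w) ((hg w z).1 hw), fun h w hw => h (g.symm w)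
    ((hg _ _).2 (by rwa [Equiv.apply_symm_apply]))⟩

/-- A subtree is its top vertex together with the disjoint subtrees of the offspring, so
isomorphisms of the latter glue. Edges out of the top are respected because an isomorphism sends top
to top. -/
theorem vertexEquiv_of_children (hlev : ∀ x y, tree x y → lev y = lev x + 1)
    (huniq : ∀ x x' y, tree x y → tree x' y → x = x') {x y : V}
    (e : {c // tree x c} ≃ {c // tree y c}) (he : ∀ c, VertexEquiv tree c.1 (e c).1) :
    VertexEquiv tree x y := by
  choose g hg using he
  let φ := fun x => Equiv.ofBijective _ (ofChildren_bijective hlev huniq x)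
  have hφ : ∀ x o, φ x o = ofChildren tree x o := fun _ _ => rfl
  refine ⟨(φ x).symm.trans ((Equiv.optionCongr (Equiv.sigmaCongr e g)).trans (φ y)), ?_⟩
  intro a b
  obtain ⟨o, rfl⟩ := (φ x).surjective a
  obtain ⟨o', rfl⟩ := (φ x).surjective b
  simp only [Equiv.trans_apply, Equiv.symm_apply_apply]
  simp only [hφ, tree_ofChildren_iff hlev huniq]
  rcases o with _ | ⟨c, z⟩ <;> rcases o' with _ | ⟨c', z'⟩
  · exact Iff.rfl
  · exact (map_top_iff hlev (g c') (hg c') z').symm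
  · exact Iff.rfl
  · change c = c' ∧ tree z.1 z'.1 ↔ e c = e c' ∧ tree (g c z).1 (g c' z').1
    rw [e.injective.eq_iff]
    refine and_congr_right fun h => ?_
    subst h
    exact hg c z z'

/-- Different classes of vertices have different rows in the incidence matrix. -/
theorem IsTreeIncidence.injective {root : V} {n : ℕ} [NeZero n] {typ : V → Fin n}
    {B : Matrix (Fin n) (Fin n) ℕ} (h : IsTreeIncidence tree root typ B)
    (hlev : ∀ x y, tree x y → lev y = lev x + 1)
    (huniq : ∀ x x' y, tree x y → tree x' y → x = x') (hfin : ∀ x, Finite {y // tree x y})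
    {i j : Fin n} (hij : B i = B j) : i = j := by
  obtain ⟨x, rfl⟩ := h.surjective i
  obtain ⟨y, rfl⟩ := h.surjective j
  obtain ⟨e, he⟩ := exists_children_equiv (B := B) hfin hfin h.card_eq h.card_eq hij
  exact (h.eq_iff x y).2
    (vertexEquiv_of_children hlev huniq e fun c => (h.eq_iff _ _).1 (he c).symm)

end Tree

/-! ### Rearranging the edges -/

section Grouping

/-- Since the rows of `B` are distinct, the index sets `{k // D k = B j}` are disjoint. Their sizes
add up to the number of all indices, so they leave none out. -/
theorem exists_row_of_card {n : ℕ} {B : Matrix (Fin n) (Fin n) ℕ} (hB : Function.Injective B)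
    {v : Fin n → ℕ} (D : Matrix (Fin (∑ j, v j)) (Fin n) ℕ)
    (h : ∀ j, Nat.card {k // D k = B j} = v j) (k) : ∃ j, D k = B j := by
  let f : (Σ j, {k // D k = B j}) → Fin (∑ j, v j) := fun a => a.2.1
  have hf : Function.Injective f := by
    rintro ⟨j, k, hk⟩ ⟨j', k', hk'⟩ (h : k = k')
    subst h
    have := hB (hk.symm.trans hk')
    subst this
    rfl
  have hb : Function.Bijective f := (Nat.bijective_iff_injective_and_card f).2
    ⟨hf, by rw [Nat.card_sigma, Nat.card_fin]; simp [h]⟩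
  obtain ⟨⟨j, k', hk'⟩, rfl⟩ := hb.2 k
  exact ⟨j, hk'⟩

/-- Distribute the elements of `β` over the elements of `α` as the rearrangement prescribes. -/
theorem exists_grouping {α β : Type*} [Finite α] [Finite β] {m n : ℕ}
    {B : Matrix (Fin n) (Fin n) ℕ} (hB : Function.Injective B) (U : Matrix (Fin m) (Fin n) ℕ)
    {v : Fin n → ℕ} {a : Fin m → ℕ} (typ : α → Fin n) (cls : β → Fin m)
    (htyp : ∀ j, Nat.card {x // typ x = j} = v j) (hcls : ∀ l, Nat.card {z // cls z = l} = a l)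
    (C : Matrix (Fin (∑ j, v j)) (Fin m) ℕ) (ha : a = Matrix.vecMul 1 C)
    (hC : ∀ j, Nat.card {k // (C * U) k = B j} = v j) :
    ∃ g : β → α, ∀ x j, ∑ l, Nat.card {z // g z = x ∧ cls z = l} * U l j = B (typ x) j := by
  choose row hrow using exists_row_of_card hB (C * U) hC
  have hrow' : ∀ k j, row k = j ↔ (C * U) k = B j := fun k j =>
    ⟨fun h => h ▸ hrow k, fun h => hB ((hrow k).symm.trans h)⟩
  -- Elements of `α` of type `j` correspond to indices `k` whose row of `C * U` is `B j`.
  obtain ⟨e, he⟩ := exists_equiv_of_card_fiber typ row fun j => by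
    rw [htyp, ← hC]
    exact Nat.card_congr (Equiv.subtypeEquivRight fun k => (hrow' k j).symm)
  -- The entry `C k l` is read as that many places for elements of class `l` in row `k`. The column
  -- sums are `a`, so `β` fills all the places exactly.
  obtain ⟨e', he'⟩ := exists_equiv_of_card_fiber cls
    (fun s : Σ kl : Fin (∑ j, v j) × Fin m, Fin (C kl.1 kl.2) => s.1.2) fun l => by
      let ψ : {s : Σ kl : Fin (∑ j, v j) × Fin m, Fin (C kl.1 kl.2) // s.1.2 = l} ≃
          Σ k : Fin (∑ j, v j), Fin (C k l) :=
        { toFun := fun s => ⟨s.1.1.1, Fin.cast (by rw [s.2]) s.1.2⟩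
          invFun := fun s => ⟨⟨(s.1, l), s.2⟩, rfl⟩
          left_inv := by rintro ⟨⟨⟨k, l⟩, t⟩, rfl⟩; rfl
          right_inv := fun s => rfl }
      rw [hcls, Nat.card_congr ψ, Nat.card_sigma, ha]
      simp [Matrix.vecMul, dotProduct]
  refine ⟨fun z => e.symm (e' z).1.1, fun x j => ?_⟩
  have hcard : ∀ l, Nat.card {z // e.symm (e' z).1.1 = x ∧ cls z = l} = C (e x) l := by
    intro l
    rw [← Nat.card_fin (C (e x) l)]
    let χ : {s : Σ kl : Fin (∑ j, v j) × Fin m, Fin (C kl.1 kl.2) // s.1 = (e x, l)} ≃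
        Fin (C (e x) l) := Equiv.sigmaSubtype (β := fun kl : _ × _ => Fin (C kl.1 kl.2)) (e x, l)
    refine Nat.card_congr ((e'.subtypeEquiv fun z => ?_).trans χ)
    rw [Prod.ext_iff, ← he' z, Equiv.symm_apply_eq]
  simp only [hcard]
  rw [← he x, ← hrow (e x), Matrix.mul_apply]

end Grouping

end AugTree

namespace AugTree

/-! ### Horizontal components and the rearranged parents. -/

section Leveled

variable {V : Type*}

/-- The properties of levels and edges of an augmented tree. -/
structure IsLeveled (vert : V → V → Prop) (H : SimpleGraph V) (lev : V → ℕ) : Prop where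
  vert_lev : ∀ x y, vert x y → lev y = lev x + 1
  adj_lev : ∀ x y, H.Adj x y → lev x = lev y
  exists_parent : ∀ y, lev y ≠ 0 → ∃ x, vert x y
  reachable_parent : ∀ x x' y y', vert x y → vert x' y' → (y = y' ∨ H.Adj y y') →
    H.Reachable x x'
  finite_lev : ∀ k, {x | lev x = k}.Finite

variable {vert : V → V → Prop} {H : SimpleGraph V} {lev : V → ℕ}

namespace IsLeveled

theorem lev_eq_of_reachable (h : IsLeveled vert H lev) {x y : V} (hxy : H.Reachable x y) :
    lev x = lev y := by
  obtain ⟨w⟩ := hxy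
  induction w with
  | nil => rfl
  | cons hadj _ ih => exact (h.adj_lev _ _ hadj).trans ih

/-- Each edge of a walk between `y` and `y'` lifts to a connection of parents, so the parents of a
whole component lie in one component. -/
theorem reachable_parent_of_reachable (h : IsLeveled vert H lev) {x x' y y' : V}
    (hxy : vert x y) (hxy' : vert x' y') (hy : H.Reachable y y') : H.Reachable x x' := by
  obtain ⟨w⟩ := hy
  induction w generalizing x with
  | nil => exact h.reachable_parent _ _ _ _ hxy hxy' (.inl rfl)
  | @cons a b c hadj w ih =>
    obtain ⟨z, hz⟩ := h.exists_parent b (by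
      have := h.vert_lev _ _ hxy
      have := h.adj_lev _ _ hadj
      omega)
    exact (h.reachable_parent _ _ _ _ hxy hz (.inr hadj)).trans (ih hz hxy')

/-- A single vertex with a parent in `T` suffices, because the parents of connected vertices are
connected. -/
theorem isOffspring_iff (h : IsLeveled vert H lev) (T : H.ConnectedComponent) (y : V) :
    IsOffspring vert H T (H.connectedComponentMk y) ↔
      ∃ x, vert x y ∧ H.connectedComponentMk x = T := by
  constructor
  · intro hT
    obtain ⟨x, hx, hxy⟩ := hT y rfl
    exact ⟨x, hxy, hx⟩
  · rintro ⟨x, hxy, rfl⟩ y' hy'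
    have hyy' : H.Reachable y' y := SimpleGraph.ConnectedComponent.exact hy'
    obtain ⟨x', hx'⟩ := h.exists_parent y' (by
      rw [h.lev_eq_of_reachable hyy', h.vert_lev _ _ hxy]
      exact Nat.succ_ne_zero _)
    exact ⟨x', SimpleGraph.ConnectedComponent.sound
      (h.reachable_parent_of_reachable hx' hxy hyy'), hx'⟩

theorem finite_supp (h : IsLeveled vert H lev) (T : H.ConnectedComponent) : Finite T.supp := by
  induction T using SimpleGraph.ConnectedComponent.ind with | _ x
  exact (h.finite_lev (lev x)).subset fun y hy =>
    h.lev_eq_of_reachable (SimpleGraph.ConnectedComponent.exact hy)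

theorem finite_offspring (h : IsLeveled vert H lev) (T : H.ConnectedComponent) :
    Finite {Z // IsOffspring vert H T Z} := by
  induction T using SimpleGraph.ConnectedComponent.ind with | _ x
  refine ((h.finite_lev (lev x + 1)).image H.connectedComponentMk).subset ?_
  intro Z hZ
  induction Z using SimpleGraph.ConnectedComponent.ind with | _ y
  obtain ⟨x', hx', hxx'⟩ := (h.isOffspring_iff _ y).1 hZ
  exact ⟨y, by rw [Set.mem_ofPred, h.vert_lev _ _ hx',
    h.lev_eq_of_reachable (SimpleGraph.ConnectedComponent.exact hxx')], rfl⟩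

end IsLeveled

/-- The vertices are partitioned by their components, and a component of class `l` contributes `u l
j` of them. -/
theorem card_vertices_of_components {n m : ℕ} {typ : V → Fin n} {cls : H.ConnectedComponent → Fin m}
    {u : Matrix (Fin m) (Fin n) ℕ} (hrep : IsRepresentation H cls typ u)
    (hfin : ∀ T : H.ConnectedComponent, Finite T.supp) (P : H.ConnectedComponent → Prop)
    [Finite {Z // P Z}] (j : Fin n) :
    Nat.card {y // P (H.connectedComponentMk y) ∧ typ y = j} =
      ∑ l, Nat.card {Z // P Z ∧ cls Z = l} * u l j := by
  classical
  have := Fintype.ofFinite {Z // P Z}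
  let ψ : {y // P (H.connectedComponentMk y) ∧ typ y = j} ≃
      Σ Z : {Z // P Z}, {y // y ∈ Z.1.supp ∧ typ y = j} :=
    { toFun := fun y => ⟨⟨H.connectedComponentMk y.1, y.2.1⟩, ⟨y.1, rfl, y.2.2⟩⟩
      invFun := fun s => ⟨s.2.1, by
        have h : H.connectedComponentMk s.2.1 = s.1.1 := s.2.2.1
        rw [h]
        exact s.1.2, s.2.2.2⟩
      left_inv := fun y => rfl
      right_inv := by
        rintro ⟨⟨Z, hZ⟩, ⟨y, hy, hj⟩⟩
        obtain rfl : H.connectedComponentMk y = Z := hy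
        rfl }
  have hf : ∀ Z : {Z // P Z}, Finite {y // y ∈ Z.1.supp ∧ typ y = j} := fun Z =>
    have := hfin Z.1
    Finite.of_injective (fun y => (⟨y.1, y.2.1⟩ : Z.1.supp)) fun y y' h =>
      Subtype.ext (Subtype.mk.inj h)
  rw [Nat.card_congr ψ, Nat.card_sigma]
  simp only [hrep _ j]
  rw [← Finset.sum_fiberwise_of_maps_to (g := fun Z : {Z // P Z} => cls Z.1)
    (t := Finset.univ) fun _ _ => Finset.mem_univ _]
  refine Finset.sum_congr rfl fun l _ => ?_
  rw [Finset.sum_congr rfl (g := fun _ => u l j) fun Z hZ => by rw [(Finset.mem_filter.1 hZ).2],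
    Finset.sum_const, smul_eq_mul, ← card_fiber_subtype, Nat.card_eq_fintype_card,
    Fintype.card_subtype]

/-- The edges which a rearrangement gives: the new parent of a vertex depends only on its
horizontal component, and belongs to the parent component. -/
structure IsRearrangedParent (vert : V → V → Prop) (H : SimpleGraph V) (lev : V → ℕ)
    (q : V → V) : Prop where
  eq_of_reachable : ∀ y y', H.Reachable y y' → q y = q y'
  exists_vert : ∀ y, lev y ≠ 0 → ∃ x, vert x y ∧ H.Reachable x (q y)

/-- `exists_grouping` is applied to each component `T`, with its vertices as receivers and its
offspring components as the objects to distribute. All vertices of an offspring component take the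
receiving vertex as their new parent. -/
theorem exists_rearrangedParent (h : IsLeveled vert H lev) {m n : ℕ}
    {A : Matrix (Fin m) (Fin m) ℕ} {B : Matrix (Fin n) (Fin n) ℕ} {u : Matrix (Fin m) (Fin n) ℕ}
    {cls : H.ConnectedComponent → Fin m} {typ : V → Fin n}
    (hA : ∀ T j, Nat.card {Z // IsOffspring vert H T Z ∧ cls Z = j} = A (cls T) j)
    (hrep : IsRepresentation H cls typ u) (hre : IsRearrangeable A B u)
    (hB : Function.Injective B) :
    ∃ q : V → V, IsRearrangedParent vert H lev q ∧
      ∀ x j, Nat.card {y // (lev y ≠ 0 ∧ q y = x) ∧ typ y = j} = B (typ x) j := by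
  classical
  have hfin := h.finite_supp
  have hoff := h.finite_offspring
  have hg : ∀ T : H.ConnectedComponent, ∃ g : {Z // IsOffspring vert H T Z} → T.supp,
      ∀ x j, ∑ l, Nat.card {Z // g Z = x ∧ cls Z.1 = l} * u l j = B (typ x.1) j := by
    intro T
    obtain ⟨C, hC, hC'⟩ := hre (cls T)
    refine exists_grouping hB u (fun x : T.supp => typ x.1)
      (fun Z : {Z // IsOffspring vert H T Z} => cls Z.1) (fun j => ?_) (fun l => ?_) C hC hC'
    · rw [← hrep T j]
      exact card_fiber_subtype (fun x => x ∈ T.supp) typ j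
    · rw [← hA T l]
      exact card_fiber_subtype _ cls l
  choose g hg using hg
  -- An arbitrary old parent, used only to name the parent component. The value `y` on level 0 makes
  -- `par` respect components there too.
  let par : V → V := fun y => if hy : lev y ≠ 0 then (h.exists_parent y hy).choose else y
  have hpar : ∀ y, lev y ≠ 0 → vert (par y) y := by
    intro y hy
    simp only [par, dif_pos hy]
    exact (h.exists_parent y hy).choose_spec
  let G : H.ConnectedComponent → H.ConnectedComponent → V := fun T Z =>
    if hZ : IsOffspring vert H T Z then (g T ⟨Z, hZ⟩).1 else T.nonempty_supp.some
  have hG : ∀ T Z (hZ : IsOffspring vert H T Z), G T Z = (g T ⟨Z, hZ⟩).1 :=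
    fun T Z hZ => dif_pos hZ
  have hGT : ∀ T Z, H.connectedComponentMk (G T Z) = T := by
    intro T Z
    by_cases hZ : IsOffspring vert H T Z
    · rw [hG T Z hZ]
      exact (g T ⟨Z, hZ⟩).2
    · simp only [G, dif_neg hZ]
      exact T.nonempty_supp.some_mem
  have hparr : ∀ y y', H.Reachable y y' →
      H.connectedComponentMk (par y) = H.connectedComponentMk (par y') := by
    intro y y' hyy'
    rw [SimpleGraph.ConnectedComponent.eq]
    have hl := h.lev_eq_of_reachable hyy'
    by_cases hy : lev y = 0
    · have h1 : par y = y := dif_neg (not_not.2 hy)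
      have h2 : par y' = y' := dif_neg (not_not.2 (hl ▸ hy))
      rwa [h1, h2]
    · exact h.reachable_parent_of_reachable (hpar y hy) (hpar y' (hl ▸ hy)) hyy'
  refine ⟨fun y => G (H.connectedComponentMk (par y)) (H.connectedComponentMk y),
    ⟨fun y y' hyy' => ?_, fun y hy => ⟨par y, hpar y hy, ?_⟩⟩, fun x j => ?_⟩
  · simp only [hparr y y' hyy', SimpleGraph.ConnectedComponent.sound hyy']
  · exact SimpleGraph.ConnectedComponent.exact (hGT _ _).symm
  · set T := H.connectedComponentMk x with hT
    let P : H.ConnectedComponent → Prop := fun Z => IsOffspring vert H T Z ∧ G T Z = x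
    have hP : Finite {Z // P Z} :=
      Finite.of_injective (fun Z => (⟨Z.1, Z.2.1⟩ : {Z // IsOffspring vert H T Z}))
        fun Z Z' hZ => Subtype.ext (Subtype.mk.inj hZ)
    rw [← hg T ⟨x, rfl⟩ j]
    -- The new offspring of `x` fill whole components, namely those assigned to `x`, so they can be
    -- counted by class.
    have key : ∀ y, (lev y ≠ 0 ∧ G (H.connectedComponentMk (par y)) (H.connectedComponentMk y) = x)
        ↔ P (H.connectedComponentMk y) := by
      intro y
      constructor
      · rintro ⟨hy, hx⟩
        have hT' : H.connectedComponentMk (par y) = T := by rw [hT, ← hx, hGT]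
        exact ⟨(h.isOffspring_iff _ _).2 ⟨par y, hpar y hy, hT'⟩, by rw [← hT', hx]⟩
      · rintro ⟨h1, h2⟩
        obtain ⟨x', hx', hx'T⟩ := (h.isOffspring_iff _ _).1 h1
        have hy : lev y ≠ 0 := by
          rw [h.vert_lev _ _ hx']
          exact Nat.succ_ne_zero _
        refine ⟨hy, ?_⟩
        rw [← h2, ← hx'T]
        congr 1
        exact SimpleGraph.ConnectedComponent.sound
          (h.reachable_parent_of_reachable (hpar y hy) hx' .rfl)
    rw [Nat.card_congr (Equiv.subtypeEquivRight fun y => and_congr_left' (key y)),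
      card_vertices_of_components hrep hfin P j]
    refine Finset.sum_congr rfl fun l _ => congrArg (· * u l j) ?_
    let ψ : {Z // P Z ∧ cls Z = l} ≃
        {Z : {Z // IsOffspring vert H T Z} // g T Z = ⟨x, rfl⟩ ∧ cls Z.1 = l} :=
      { toFun := fun Z => ⟨⟨Z.1, Z.2.1.1⟩, Subtype.ext (by rw [← hG, Z.2.1.2]), Z.2.2⟩
        invFun := fun Z => ⟨Z.1.1, ⟨Z.1.2, by rw [hG _ _ Z.1.2, Z.2.1]⟩, Z.2.2⟩
        left_inv := fun _ => rfl
        right_inv := fun _ => rfl }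
    exact Nat.card_congr ψ

end Leveled

end AugTree

namespace AugTree

/-! ### From nested pieces to the boundary of the rearranged tree. -/

section Pieces

variable {V Z : Type*} [MetricSpace Z]

/-- A space which is decomposed into the nested pieces `piece x` that belong to the vertices of an
augmented tree. -/
structure IsPieceSystem (vert : V → V → Prop) (H : SimpleGraph V) (lev : V → ℕ) (root : V)
    (piece : V → Set Z) (s κ D : ℝ) : Prop where
  vert_lev : ∀ x y, vert x y → lev y = lev x + 1
  exists_parent : ∀ y, lev y ≠ 0 → ∃ x, vert x y
  finite_lev : ∀ k, {x | lev x = k}.Finite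
  lev_root : lev root = 0
  eq_root : ∀ x, lev x = 0 → x = root
  nonempty : ∀ x, (piece x).Nonempty
  isCompact : ∀ x, IsCompact (piece x)
  piece_root : piece root = Set.univ
  subset : ∀ x y, vert x y → piece y ⊆ piece x
  exists_child : ∀ x, ∀ a ∈ piece x, ∃ y, vert x y ∧ a ∈ piece y
  adj_iff : ∀ x y, H.Adj x y ↔ x ≠ y ∧ lev x = lev y ∧
    ∃ a ∈ piece x, ∃ b ∈ piece y, dist a b ≤ κ * s ^ lev x
  dist_le : ∀ x, ∀ a ∈ piece x, ∀ b ∈ piece x, dist a b ≤ D * s ^ lev x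

variable {vert : V → V → Prop} {H : SimpleGraph V} {lev : V → ℕ} {root : V} {piece : V → Set Z}
  {s : Set.Ioo (0 : ℝ) 1} {κ D : ℝ}

namespace IsPieceSystem

theorem reachable_of_mem (h : IsPieceSystem vert H lev root piece s κ D) (hκ : 0 < κ) {x y : V}
    (hl : lev x = lev y) {a : Z} (hx : a ∈ piece x) (hy : a ∈ piece y) : H.Reachable x y := by
  by_cases hxy : x = y
  · rw [hxy]
  · refine ((h.adj_iff x y).2 ⟨hxy, hl, a, hx, a, hy, ?_⟩).reachable
    rw [dist_self]
    exact mul_nonneg hκ.le (pow_nonneg s.2.1.le _)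

/-- Close pieces have close parents: pieces only grow towards the root, and the admissible gap `κ *
s ^ k` grows with them. -/
theorem isLeveled (h : IsPieceSystem vert H lev root piece s κ D) (hκ : 0 < κ) :
    IsLeveled vert H lev where
  vert_lev := h.vert_lev
  adj_lev x y hxy := ((h.adj_iff x y).1 hxy).2.1
  exists_parent := h.exists_parent
  finite_lev := h.finite_lev
  reachable_parent := by
    intro x x' y y' hx hx' hyy'
    rcases hyy' with rfl | hyy'
    · obtain ⟨a, ha⟩ := h.nonempty y
      refine h.reachable_of_mem hκ ?_ (h.subset _ _ hx ha) (h.subset _ _ hx' ha)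
      have h1 := h.vert_lev _ _ hx
      have h2 := h.vert_lev _ _ hx'
      omega
    · obtain ⟨-, hl, a, ha, b, hb, hab⟩ := (h.adj_iff _ _).1 hyy'
      by_cases hxx' : x = x'
      · rw [hxx']
      · have h1 := h.vert_lev _ _ hx
        have h2 := h.vert_lev _ _ hx'
        refine ((h.adj_iff _ _).2 ⟨hxx', by omega, a, h.subset _ _ hx ha, b,
          h.subset _ _ hx' hb, hab.trans (mul_le_mul_of_nonneg_left ?_ hκ.le)⟩).reachable
        exact pow_le_pow_of_le_one s.2.1.le s.2.2.le (by omega)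

theorem exists_mem (h : IsPieceSystem vert H lev root piece s κ D) (a : Z) (k : ℕ) :
    ∃ x, lev x = k ∧ a ∈ piece x := by
  induction k with
  | zero => exact ⟨root, h.lev_root, by rw [h.piece_root]; trivial⟩
  | succ k ih =>
    obtain ⟨x, hx, ha⟩ := ih
    obtain ⟨y, hxy, hy⟩ := h.exists_child x a ha
    exact ⟨y, by rw [h.vert_lev _ _ hxy, hx], hy⟩

/-- Each vertex of the walk costs at most one diameter `D * s ^ k`, and each edge one gap `κ * s ^
k`. -/
theorem dist_le_of_walk (h : IsPieceSystem vert H lev root piece s κ D) {x y : V}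
    (w : H.Walk x y) {a b : Z} (ha : a ∈ piece x) (hb : b ∈ piece y) :
    dist a b ≤ (D + w.length * (D + κ)) * (s : ℝ) ^ lev x := by
  induction w generalizing a with
  | nil => simpa using h.dist_le _ a ha b hb
  | @cons x z y hadj w ih =>
    obtain ⟨-, hl, c, hc, d, hd, hcd⟩ := (h.adj_iff _ _).1 hadj
    have h1 := h.dist_le x a ha c hc
    have h2 := ih hd hb
    rw [← hl] at h2
    have h3 := dist_triangle4 a c d b
    rw [SimpleGraph.Walk.length_cons]
    push_cast
    linarith

/-- A path visits each vertex of its component at most once, so its length is at most `M`. -/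
theorem dist_le_of_reachable (h : IsPieceSystem vert H lev root piece s κ D) (hκ : 0 < κ)
    (hD : 0 ≤ D) {M : ℕ} (hM : ∀ T : H.ConnectedComponent, Nat.card T.supp ≤ M) {x y : V}
    (hxy : H.Reachable x y) {a b : Z} (ha : a ∈ piece x) (hb : b ∈ piece y) :
    dist a b ≤ (D + M * (D + κ)) * (s : ℝ) ^ lev x := by
  classical
  obtain ⟨w, hw⟩ := hxy.exists_isPath
  have := (h.isLeveled hκ).finite_supp (H.connectedComponentMk x)
  have hlen : w.length ≤ M := by
    have h1 : w.support.toFinset.card = w.length + 1 := by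
      rw [List.toFinset_card_of_nodup hw.support_nodup, SimpleGraph.Walk.length_support]
    have h2 : (w.support.toFinset : Set V) ⊆ (H.connectedComponentMk x).supp := by
      intro z hz
      have hz' : z ∈ w.support := by simpa using hz
      exact SimpleGraph.ConnectedComponent.sound (w.takeUntil z hz').reachable.symm
    have h3 := Set.ncard_le_ncard h2 (Set.toFinite _)
    rw [Set.ncard_coe_finset] at h3
    have h4 := hM (H.connectedComponentMk x)
    rw [Nat.card_coe_set_eq] at h4
    omega
  refine (h.dist_le_of_walk w ha hb).trans
    (mul_le_mul_of_nonneg_right ?_ (pow_nonneg s.2.1.le _))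
  have : (w.length : ℝ) ≤ M := by exact_mod_cast hlen
  have := mul_le_mul_of_nonneg_right this (add_nonneg hD hκ.le)
  linarith

/-- A space with pieces is the boundary of the tree which results from a rearrangement of the
edges, if the horizontal components are bounded. -/
theorem lipEquiv_boundary (h : IsPieceSystem vert H lev root piece s κ D) (hκ : 0 < κ)
    (hD : 0 ≤ D) {M : ℕ} (hM : ∀ T : H.ConnectedComponent, Nat.card T.supp ≤ M) {q : V → V}
    (hq : IsRearrangedParent vert H lev q) :
    LipEquiv Z (Boundary (fun x y => lev y ≠ 0 ∧ q y = x) root s) := by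
  have hL := h.isLeveled hκ
  choose y hlev hmem using h.exists_mem
  have hqlev : ∀ z, lev z ≠ 0 → lev z = lev (q z) + 1 := by
    intro z hz
    obtain ⟨x, hx, hxq⟩ := hq.exists_vert z hz
    rw [h.vert_lev _ _ hx, hL.lev_eq_of_reachable hxq]
  have hzero : ∀ a k, lev (y a (k + 1)) ≠ 0 := fun a k => by rw [hlev]; exact Nat.succ_ne_zero k
  -- The vertex `q (y a (k + 1))` lies in the level-`k` component of `a`, although its own piece
  -- need not contain `a`.
  have hq' : ∀ a k, ∀ z, lev z = k → a ∈ piece z → H.Reachable (q (y a (k + 1))) z := by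
    intro a k z hz haz
    obtain ⟨x, hx, hxq⟩ := hq.exists_vert _ (hzero a k)
    refine hxq.symm.trans (h.reachable_of_mem hκ ?_ (h.subset _ _ hx (hmem a (k + 1))) haz)
    have := h.vert_lev _ _ hx
    rw [hlev] at this
    omega
  have hql : ∀ a k, lev (q (y a (k + 1))) = k := fun a k =>
    (hL.lev_eq_of_reachable (hq' a k _ (hlev a k) (hmem a k))).trans (hlev a k)
  -- The vertex at time `k` is read from the component on level `k + 1`; this shift is why the lower
  -- constant is `κ * s`.
  let f : Z → Boundary (fun x y => lev y ≠ 0 ∧ q y = x) root s := fun a =>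
    { path := fun k => q (y a (k + 1))
      zero := h.eq_root _ (hql a 0)
      edge := fun k => ⟨by rw [hql]; exact Nat.succ_ne_zero k,
        hq.eq_of_reachable _ _ (hq' a (k + 1) _ (hlev _ _) (hmem _ _))⟩ }
  refine lipEquiv_boundary_of_code f ?_ (c := κ * s) (C := D + M * (D + κ))
    (mul_pos hκ s.2.1) ?_ ?_
  · intro p
    have hplev : ∀ k, lev (p.path k) = k := by
      intro k
      induction k with
      | zero => rw [p.zero, h.lev_root]
      | succ k ih =>
        have := hqlev _ (p.edge k).1
        rw [(p.edge k).2, ih] at this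
        exact this
    -- The points whose level-`k` component is that of `p.path k`. These sets are compact, nonempty
    -- and decreasing, and a common point has code `p`.
    let W : ℕ → Set Z := fun k => ⋃ x ∈ (H.connectedComponentMk (p.path k)).supp, piece x
    have hWc : ∀ k, IsCompact (W k) := fun k =>
      have := hL.finite_supp (H.connectedComponentMk (p.path k))
      (Set.toFinite _).isCompact_biUnion fun x _ => h.isCompact x
    obtain ⟨a, ha⟩ := IsCompact.nonempty_iInter_of_sequence_nonempty_isCompact_isClosed W
      (fun k => by
        intro a ha
        obtain ⟨x, hx, hax⟩ := Set.mem_iUnion₂.1 ha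
        have hr : H.Reachable x (p.path (k + 1)) := SimpleGraph.ConnectedComponent.exact hx
        obtain ⟨z, hz, hzq⟩ := hq.exists_vert x (by
          rw [hL.lev_eq_of_reachable hr, hplev]
          exact Nat.succ_ne_zero k)
        rw [hq.eq_of_reachable _ _ hr, (p.edge k).2] at hzq
        exact Set.mem_iUnion₂.2 ⟨z, SimpleGraph.ConnectedComponent.sound hzq,
          h.subset _ _ hz hax⟩)
      (fun k => (h.nonempty (p.path k)).mono (Set.subset_biUnion_of_mem (u := piece) rfl))
      (hWc 0) (fun k => (hWc k).isClosed)
    refine ⟨a, Boundary.ext (funext fun k => ?_)⟩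
    obtain ⟨x, hx, hax⟩ := Set.mem_iUnion₂.1 (Set.mem_iInter.1 ha (k + 1))
    have hr : H.Reachable x (p.path (k + 1)) := SimpleGraph.ConnectedComponent.exact hx
    have hxl : lev x = k + 1 := by rw [hL.lev_eq_of_reachable hr, hplev]
    change q (y a (k + 1)) = p.path k
    rw [← (p.edge k).2, ← hq.eq_of_reachable _ _ hr]
    exact hq.eq_of_reachable _ _
      (h.reachable_of_mem hκ (by rw [hlev, hxl]) (hmem a (k + 1)) hax)
  · intro a b k hab
    have hab' : q (y a (k + 1)) = q (y b (k + 1)) := hab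
    have h1 := hq' a k _ (hlev a k) (hmem a k)
    have h2 := hq' b k _ (hlev b k) (hmem b k)
    rw [hab'] at h1
    have := h.dist_le_of_reachable hκ hD hM (h1.symm.trans h2) (hmem a k) (hmem b k)
    rwa [hlev] at this
  · intro a b k hab
    by_contra! hlt
    apply hab
    refine hq.eq_of_reachable _ _ ?_
    by_cases hy : y a (k + 1) = y b (k + 1)
    · rw [hy]
    · refine ((h.adj_iff _ _).2 ⟨hy, by rw [hlev, hlev], a, hmem _ _, b, hmem _ _, ?_⟩).reachable
      rw [hlev, pow_succ, mul_comm _ (s : ℝ), ← mul_assoc]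
      exact hlt.le

end IsPieceSystem

end Pieces

end AugTree

namespace AugTree

/-! ### Words and their levels -/

section Words

variable {N : ℕ} {ρ : Fin N → ℝ}

theorem wordRatio_append (u v : List (Fin N)) :
    wordRatio ρ (u ++ v) = wordRatio ρ u * wordRatio ρ v := by
  simp [wordRatio]

theorem wordRatio_concat (u : List (Fin N)) (i : Fin N) :
    wordRatio ρ (u ++ [i]) = wordRatio ρ u * ρ i := by
  simp [wordRatio]

theorem wordRatio_pos (hρ : ∀ i, 0 < ρ i ∧ ρ i < 1) (w : List (Fin N)) : 0 < wordRatio ρ w :=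
  List.prod_pos fun a ha => by
    obtain ⟨i, -, rfl⟩ := List.mem_map.1 ha
    exact (hρ i).1

theorem wordRatio_le_one (hρ : ∀ i, 0 < ρ i ∧ ρ i < 1) (w : List (Fin N)) :
    wordRatio ρ w ≤ 1 := by
  induction w with
  | nil => simp [wordRatio]
  | cons i w ih =>
    have : wordRatio ρ (i :: w) = ρ i * wordRatio ρ w := by simp [wordRatio]
    rw [this]
    exact mul_le_one₀ (hρ i).2.le (wordRatio_pos hρ w).le ih

theorem wordRatio_le_of_prefix (hρ : ∀ i, 0 < ρ i ∧ ρ i < 1) {u w : List (Fin N)} (h : u <+: w) :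
    wordRatio ρ w ≤ wordRatio ρ u := by
  obtain ⟨v, rfl⟩ := h
  rw [wordRatio_append]
  exact mul_le_of_le_one_right (wordRatio_pos hρ u).le (wordRatio_le_one hρ v)

theorem wordRatio_le_pow {c : ℝ} (hρ : ∀ i, 0 < ρ i ∧ ρ i < 1) (hc : ∀ i, ρ i ≤ c)
    (w : List (Fin N)) : wordRatio ρ w ≤ c ^ w.length := by
  induction w with
  | nil => simp [wordRatio]
  | cons i w ih =>
    have : wordRatio ρ (i :: w) = ρ i * wordRatio ρ w := by simp [wordRatio]
    rw [this, List.length_cons, pow_succ']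
    exact mul_le_mul (hc i) ih (wordRatio_pos hρ w).le ((hρ i).1.le.trans (hc i))

theorem exists_ratio_bound (hρ : ∀ i, 0 < ρ i ∧ ρ i < 1) :
    ∃ c : ℝ, 0 < c ∧ c < 1 ∧ ∀ i, ρ i ≤ c := by
  rcases isEmpty_or_nonempty (Fin N) with h | h
  · exact ⟨1 / 2, by norm_num, by norm_num, fun i => h.elim i⟩
  · obtain ⟨i, hi⟩ := Finite.exists_max ρ
    exact ⟨ρ i, (hρ i).1, (hρ i).2, hi⟩

theorem minRatio_le (i : Fin N) : minRatio ρ ≤ ρ i := ciInf_le (Set.finite_range ρ).bddBelow i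

theorem minRatio_mem_Ioo [Nonempty (Fin N)] (hρ : ∀ i, 0 < ρ i ∧ ρ i < 1) :
    minRatio ρ ∈ Set.Ioo (0 : ℝ) 1 := by
  obtain ⟨i, hi⟩ := exists_eq_ciInf_of_finite (f := ρ)
  exact ⟨by rw [minRatio, ← hi]; exact (hρ i).1, by rw [minRatio, ← hi]; exact (hρ i).2⟩

theorem lt_wordRatio_of_ssubprefix (hρ : ∀ i, 0 < ρ i ∧ ρ i < 1) {k : ℕ} {u v w : List (Fin N)}
    (hw : w ∈ levelWords ρ k) (h : w = u ++ v) (hv : v ≠ []) : minRatio ρ ^ k < wordRatio ρ u := by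
  have hw0 : w ≠ [] := by rw [h]; exact List.append_ne_nil_of_right_ne_nil u hv
  refine (hw.2 hw0).trans_le (wordRatio_le_of_prefix hρ ?_)
  rw [h, List.dropLast_append_of_ne_nil hv]
  exact List.prefix_append _ _

/-- The last letter costs at most a factor `r`, so a word of level `k` is never short enough in
ratio for level `k + 1`, and an offspring is a proper extension. -/
theorem lt_wordRatio [Nonempty (Fin N)] (hρ : ∀ i, 0 < ρ i ∧ ρ i < 1) {k : ℕ} {w : List (Fin N)}
    (hw : w ∈ levelWords ρ k) : minRatio ρ ^ (k + 1) < wordRatio ρ w := by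
  have hm := minRatio_mem_Ioo hρ
  rcases List.eq_nil_or_concat' w with rfl | ⟨u, i, rfl⟩
  · simpa [wordRatio] using pow_lt_one₀ hm.1.le hm.2 (Nat.succ_ne_zero k)
  · have h := lt_wordRatio_of_ssubprefix hρ hw rfl (List.cons_ne_nil i [])
    rw [wordRatio_concat, pow_succ]
    exact (mul_lt_mul_of_pos_right h hm.1).trans_le
      (mul_le_mul_of_nonneg_left (minRatio_le i) (wordRatio_pos hρ u).le)

theorem eq_of_prefix_of_mem_levelWords (hρ : ∀ i, 0 < ρ i ∧ ρ i < 1) {k : ℕ}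
    {u w : List (Fin N)} (hu : u ∈ levelWords ρ k) (hw : w ∈ levelWords ρ k) (h : u <+: w) :
    u = w := by
  obtain ⟨v, rfl⟩ := h
  by_contra hne
  have hv : v ≠ [] := fun h => hne (by rw [h, List.append_nil])
  exact absurd hu.1 (not_le.2 (lt_wordRatio_of_ssubprefix hρ hw rfl hv))

theorem exists_prefix_mem_levelWords {k : ℕ} (w : List (Fin N))
    (hw : wordRatio ρ w ≤ minRatio ρ ^ k) : ∃ u ∈ levelWords ρ k, u <+: w := by
  induction w using List.reverseRecOn with
  | nil => exact ⟨[], ⟨hw, fun h => absurd rfl h⟩, List.prefix_rfl⟩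
  | append_singleton w i ih =>
    by_cases h : wordRatio ρ w ≤ minRatio ρ ^ k
    · obtain ⟨u, hu, huw⟩ := ih h
      exact ⟨u, hu, huw.trans (List.prefix_append _ _)⟩
    · exact ⟨w ++ [i], ⟨hw, fun _ => by simpa using h⟩, List.prefix_rfl⟩

theorem Vert.level_eq (x y : Vertex ρ) (h : Vert x y) : y.level = x.level + 1 := h.1

theorem Vert.left_unique (hρ : ∀ i, 0 < ρ i ∧ ρ i < 1) (x x' y : Vertex ρ) (h : Vert x y)
    (h' : Vert x' y) : x = x' := by
  have hl : x.level = x'.level := by have := h.1; have := h'.1; omega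
  refine Vertex.ext hl ?_
  rcases List.prefix_or_prefix_of_prefix h.2 h'.2 with hp | hp
  · exact eq_of_prefix_of_mem_levelWords hρ x.mem (hl ▸ x'.mem) hp
  · exact (eq_of_prefix_of_mem_levelWords hρ (hl ▸ x'.mem) x.mem hp).symm

theorem exists_vert [Nonempty (Fin N)] (hρ : ∀ i, 0 < ρ i ∧ ρ i < 1) (y : Vertex ρ)
    (hy : y.level ≠ 0) : ∃ x, Vert x y := by
  obtain ⟨k, hk⟩ := Nat.exists_eq_succ_of_ne_zero hy
  have hm := minRatio_mem_Ioo hρ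
  have h1 := y.mem.1
  rw [hk] at h1
  obtain ⟨u, hu, huy⟩ := exists_prefix_mem_levelWords y.word
    (h1.trans (pow_le_pow_of_le_one hm.1.le hm.2.le (Nat.le_succ k)))
  exact ⟨⟨k, u, hu⟩, hk, huy⟩

theorem eq_root_of_level_eq_zero (hρ : ∀ i, 0 < ρ i ∧ ρ i < 1) (x : Vertex ρ)
    (hx : x.level = 0) : x = root ρ := by
  refine Vertex.ext hx ?_
  by_contra hne
  have h := x.mem.2 hne
  rw [hx, pow_zero] at h
  exact absurd (wordRatio_le_one hρ _) (not_le.2 h)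

theorem finite_level [Nonempty (Fin N)] (hρ : ∀ i, 0 < ρ i ∧ ρ i < 1) (k : ℕ) :
    {x : Vertex ρ | x.level = k}.Finite := by
  obtain ⟨c, hc0, hc1, hc⟩ := exists_ratio_bound hρ
  -- In a word longer than `b`, dropping the last letter would leave a ratio of at most `c ^ b`,
  -- below the `k`-th power of `r`.
  obtain ⟨b, hb⟩ := exists_pow_lt_of_lt_one (pow_pos (minRatio_mem_Ioo hρ).1 k) hc1
  refine Set.Finite.of_finite_image (f := Vertex.word)
    ((List.finite_length_le (Fin N) b).subset ?_) ?_
  · rintro _ ⟨x, hx, rfl⟩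
    rw [Set.mem_ofPred] at hx ⊢
    by_contra! hlen
    have h0 : x.word ≠ [] := by
      intro h
      rw [h] at hlen
      simp at hlen
    have h1 := x.mem.2 h0
    have h2 := wordRatio_le_pow hρ hc x.word.dropLast
    have h3 : c ^ x.word.dropLast.length ≤ c ^ b :=
      pow_le_pow_of_le_one hc0.le hc1.le (by rw [List.length_dropLast]; omega)
    rw [hx] at h1
    linarith
  · intro x hx y hy h
    exact Vertex.ext (hx.trans hy.symm) h

end Words

/-! ### Word maps and the pieces of a self-similar set. -/

namespace IFS

variable {d N : ℕ} {ρ : Fin N → ℝ} (S : IFS d ρ) {K : Set (EuclideanSpace ℝ (Fin d))}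

theorem wordMap_append (u v : List (Fin N)) : S.wordMap (u ++ v) = S.wordMap u ∘ S.wordMap v := by
  induction u with
  | nil => rfl
  | cons i u ih =>
    change S.map i ∘ S.wordMap (u ++ v) = _
    rw [ih]
    rfl

theorem dist_wordMap (w : List (Fin N)) (x y : EuclideanSpace ℝ (Fin d)) :
    dist (S.wordMap w x) (S.wordMap w y) = wordRatio ρ w * dist x y := by
  induction w with
  | nil => simp [wordRatio, wordMap]
  | cons i w ih =>
    have : wordRatio ρ (i :: w) = ρ i * wordRatio ρ w := by simp [wordRatio]
    change dist (S.map i (S.wordMap w x)) (S.map i (S.wordMap w y)) = _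
    rw [S.dist_map, ih, this, mul_assoc]

theorem continuous_wordMap (w : List (Fin N)) : Continuous (S.wordMap w) :=
  (LipschitzWith.of_dist_le_mul (K := Real.toNNReal (wordRatio ρ w)) fun x y => by
    rw [S.dist_wordMap]
    exact mul_le_mul_of_nonneg_right (Real.le_coe_toNNReal _) dist_nonneg).continuous

variable {S}

theorem IsSelfSimilarSet.wordMap_image_subset (hK : S.IsSelfSimilarSet K) (w : List (Fin N)) :
    S.wordMap w '' K ⊆ K := by
  induction w with
  | nil => simp [wordMap]
  | cons i w ih =>
    change (S.map i ∘ S.wordMap w) '' K ⊆ K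
    rw [Set.image_comp]
    refine (Set.image_mono ih).trans ?_
    conv_rhs => rw [hK.eq_iUnion]
    exact Set.subset_iUnion (fun i => S.map i '' K) i

theorem IsSelfSimilarSet.image_subset_of_prefix (hK : S.IsSelfSimilarSet K) {u w : List (Fin N)}
    (h : u <+: w) : S.wordMap w '' K ⊆ S.wordMap u '' K := by
  obtain ⟨v, rfl⟩ := h
  rw [wordMap_append, Set.image_comp]
  exact Set.image_mono (hK.wordMap_image_subset v)

theorem IsSelfSimilarSet.exists_mem_concat (hK : S.IsSelfSimilarSet K) (w : List (Fin N))
    {a : EuclideanSpace ℝ (Fin d)} (ha : a ∈ S.wordMap w '' K) :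
    ∃ i, a ∈ S.wordMap (w ++ [i]) '' K := by
  obtain ⟨b, hb, rfl⟩ := ha
  rw [hK.eq_iUnion] at hb
  obtain ⟨i, c, hc, rfl⟩ := Set.mem_iUnion.1 hb
  exact ⟨i, c, hc, by rw [wordMap_append]; rfl⟩

theorem IsSelfSimilarSet.exists_vert_mem [Nonempty (Fin N)] (hK : S.IsSelfSimilarSet K)
    (hρ : ∀ i, 0 < ρ i ∧ ρ i < 1) (x : Vertex ρ) {a : EuclideanSpace ℝ (Fin d)}
    (ha : a ∈ S.wordMap x.word '' K) : ∃ y, Vert x y ∧ a ∈ S.wordMap y.word '' K := by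
  obtain ⟨c, hc0, hc1, hc⟩ := exists_ratio_bound hρ
  set t := minRatio ρ ^ (x.level + 1) with ht
  have ht0 : 0 < t := pow_pos (minRatio_mem_Ioo hρ).1 _
  -- Letters are appended, staying in pieces that contain `a`, until the ratio first drops to `t`.
  -- The number `b` bounds how many more letters are needed.
  have key : ∀ (b : ℕ) (w : List (Fin N)), x.word <+: w → a ∈ S.wordMap w '' K →
      t < wordRatio ρ w → c ^ b * wordRatio ρ w ≤ t →
      ∃ y, Vert x y ∧ a ∈ S.wordMap y.word '' K := by
    intro b
    induction b with
    | zero =>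
      intro w _ _ h1 h2
      rw [pow_zero, one_mul] at h2
      exact absurd h1 (not_lt.2 h2)
    | succ b ih =>
      intro w hw haw h1 h2
      obtain ⟨i, hi⟩ := hK.exists_mem_concat w haw
      have hwi : x.word <+: w ++ [i] := hw.trans (List.prefix_append _ _)
      by_cases h : wordRatio ρ (w ++ [i]) ≤ t
      · exact ⟨⟨x.level + 1, w ++ [i], h, fun _ => by simpa using h1⟩, ⟨rfl, hwi⟩, hi⟩
      · refine ih (w ++ [i]) hwi hi (not_le.1 h) (le_trans ?_ h2)
        rw [wordRatio_concat, pow_succ, mul_assoc]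
        refine mul_le_mul_of_nonneg_left ?_ (pow_nonneg hc0.le b)
        rw [mul_comm c]
        exact mul_le_mul_of_nonneg_left (hc i) (wordRatio_pos hρ w).le
  obtain ⟨b, hb⟩ := exists_pow_lt_of_lt_one ht0 hc1
  refine key b x.word List.prefix_rfl ha (lt_wordRatio hρ x.mem) ?_
  exact (mul_le_of_le_one_right (pow_nonneg hc0.le b) (wordRatio_le_one hρ _)).trans hb.le

theorem IsSelfSimilarSet.nonempty_fin (hK : S.IsSelfSimilarSet K) : Nonempty (Fin N) := by
  obtain ⟨a, ha⟩ := hK.nonempty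
  rw [hK.eq_iUnion] at ha
  exact ⟨(Set.mem_iUnion.1 ha).choose⟩

theorem IsSelfSimilarSet.isCompact_image (hK : S.IsSelfSimilarSet K) (w : List (Fin N)) :
    IsCompact (S.wordMap w '' K) := hK.isCompact.image (S.continuous_wordMap w)

theorem IsSelfSimilarSet.dist_le (hK : S.IsSelfSimilarSet K) (hρ : ∀ i, 0 < ρ i ∧ ρ i < 1)
    (x : Vertex ρ)
    {a b : EuclideanSpace ℝ (Fin d)} (ha : a ∈ S.wordMap x.word '' K)
    (hb : b ∈ S.wordMap x.word '' K) :
    dist a b ≤ Metric.diam K * minRatio ρ ^ x.level := by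
  obtain ⟨a, ha, rfl⟩ := ha
  obtain ⟨b, hb, rfl⟩ := hb
  rw [S.dist_wordMap, mul_comm]
  have h := Metric.dist_le_diam_of_mem hK.isCompact.isBounded ha hb
  exact mul_le_mul h x.mem.1 (wordRatio_pos hρ _).le Metric.diam_nonneg

end IFS

/-- Compactness makes the infimum attained, so a horizontal edge comes with an actual pair of close
points. -/
theorem setDist_le_iff {E : Type*} [MetricSpace E] {A B : Set E} (hA : IsCompact A)
    (hB : IsCompact B) (hA0 : A.Nonempty) (hB0 : B.Nonempty) {c : ℝ} :
    setDist A B ≤ c ↔ ∃ a ∈ A, ∃ b ∈ B, dist a b ≤ c := by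
  have hbdd : BddBelow (Set.image2 dist A B) := ⟨0, by
    rintro _ ⟨a, -, b, -, rfl⟩
    exact dist_nonneg⟩
  constructor
  · intro h
    have hc : IsCompact (Set.image2 dist A B) := by
      rw [← Set.image_prod]
      exact (hA.prod hB).image continuous_dist
    obtain ⟨a, ha, b, hb, hab⟩ := hc.sInf_mem (hA0.image2 hB0)
    exact ⟨a, ha, b, hb, by rw [hab]; exact h⟩
  · rintro ⟨a, ha, b, hb, hab⟩
    exact (csInf_le hbdd ⟨a, ha, b, hb, rfl⟩).trans hab

/-! ### The augmented tree and its quotient as systems of pieces. -/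

namespace IFS

variable {d N : ℕ} {ρ : Fin N → ℝ} {S : IFS d ρ} {K : Set (EuclideanSpace ℝ (Fin d))} {κ : ℝ}

theorem IsSelfSimilarSet.hor_adj_iff (hK : S.IsSelfSimilarSet K) (x y : Vertex ρ) :
    (S.hor K κ).Adj x y ↔ x ≠ y ∧ x.level = y.level ∧ ∃ a ∈ S.wordMap x.word '' K,
      ∃ b ∈ S.wordMap y.word '' K, dist a b ≤ κ * minRatio ρ ^ x.level :=
  and_congr_right fun _ => and_congr_right fun _ => setDist_le_iff (hK.isCompact_image _)
    (hK.isCompact_image _) (hK.nonempty.image _) (hK.nonempty.image _)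

theorem IsSelfSimilarSet.isPieceSystem (hK : S.IsSelfSimilarSet K)
    (hρ : ∀ i, 0 < ρ i ∧ ρ i < 1) (κ : ℝ) :
    IsPieceSystem Vert (S.hor K κ) Vertex.level (root ρ)
      (fun x => (Subtype.val ⁻¹' (S.wordMap x.word '' K) : Set K)) (minRatio ρ) κ
      (Metric.diam K) := by
  have := hK.nonempty_fin
  exact
  { vert_lev := Vert.level_eq
    exists_parent := exists_vert hρ
    finite_lev := finite_level hρ
    lev_root := rfl
    eq_root := eq_root_of_level_eq_zero hρ
    nonempty := fun x => by
      obtain ⟨a, ha⟩ := hK.nonempty.image (S.wordMap x.word)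
      exact ⟨⟨a, hK.wordMap_image_subset _ ha⟩, ha⟩
    isCompact := fun x => by
      rw [Subtype.isCompact_iff, Subtype.image_preimage_coe,
        Set.inter_eq_right.2 (hK.wordMap_image_subset _)]
      exact hK.isCompact_image _
    piece_root := by
      ext a
      simp [root, wordMap]
    subset := fun x y hxy => Set.preimage_mono (hK.image_subset_of_prefix hxy.2)
    exists_child := fun x a ha => hK.exists_vert_mem hρ x ha
    adj_iff := fun x y => by
      rw [hK.hor_adj_iff]
      refine and_congr_right fun _ => and_congr_right fun _ => ⟨?_, ?_⟩
      · rintro ⟨a, ha, b, hb, hab⟩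
        exact ⟨⟨a, hK.wordMap_image_subset _ ha⟩, ha, ⟨b, hK.wordMap_image_subset _ hb⟩, hb, hab⟩
      · rintro ⟨a, ha, b, hb, hab⟩
        exact ⟨a, ha, b, hb, hab⟩
    dist_le := fun x a ha b hb => hK.dist_le hρ x ha hb }

/-- The level of a vertex of the quotient. -/
def qlevel (S : IFS d ρ) : S.QVertex → ℕ := Quotient.lift Vertex.level fun _ _ h => h.1

/-- The part of `K` which belongs to a vertex of the quotient. -/
def qpiece (S : IFS d ρ) (K : Set (EuclideanSpace ℝ (Fin d))) : S.QVertex → Set K :=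
  Quotient.lift (fun x => Subtype.val ⁻¹' (S.wordMap x.word '' K)) fun _ _ h => by
    simp only [h.2]

theorem toQ_surjective (p : S.QVertex) : ∃ x, S.toQ x = p := Quotient.exists_rep p

theorem QVert.qlevel_eq (p q : S.QVertex) (h : S.QVert p q) : S.qlevel q = S.qlevel p + 1 := by
  obtain ⟨x, y, rfl, rfl, h⟩ := h
  exact h.1

theorem finite_qlevel [Nonempty (Fin N)] (hρ : ∀ i, 0 < ρ i ∧ ρ i < 1) (k : ℕ) :
    {p | S.qlevel p = k}.Finite := by
  refine ((finite_level hρ k).image S.toQ).subset ?_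
  intro p hp
  obtain ⟨x, rfl⟩ := toQ_surjective p
  exact ⟨x, hp, rfl⟩

/-- Levels and pieces are constant on classes, so each property descends from a representative. -/
theorem IsSelfSimilarSet.isPieceSystem_quotient (hK : S.IsSelfSimilarSet K)
    (hρ : ∀ i, 0 < ρ i ∧ ρ i < 1) (κ : ℝ) :
    IsPieceSystem S.QVert (S.qhor K κ) S.qlevel (S.toQ (root ρ)) (S.qpiece K) (minRatio ρ) κ
      (Metric.diam K) := by
  have := hK.nonempty_fin
  have h := hK.isPieceSystem hρ κ
  exact
  { vert_lev := QVert.qlevel_eq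
    exists_parent := fun p hp => by
      obtain ⟨y, rfl⟩ := toQ_surjective p
      obtain ⟨x, hx⟩ := h.exists_parent y hp
      exact ⟨S.toQ x, x, y, rfl, rfl, hx⟩
    finite_lev := finite_qlevel hρ
    lev_root := rfl
    eq_root := fun p hp => by
      obtain ⟨x, rfl⟩ := toQ_surjective p
      rw [h.eq_root x hp]
    nonempty := fun p => by
      obtain ⟨x, rfl⟩ := toQ_surjective p
      exact h.nonempty x
    isCompact := fun p => by
      obtain ⟨x, rfl⟩ := toQ_surjective p
      exact h.isCompact x
    piece_root := h.piece_root
    subset := by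
      rintro p q ⟨x, y, rfl, rfl, hxy⟩
      exact h.subset x y hxy
    exists_child := fun p a ha => by
      obtain ⟨x, rfl⟩ := toQ_surjective p
      obtain ⟨y, hxy, hy⟩ := h.exists_child x a ha
      exact ⟨S.toQ y, ⟨x, y, rfl, rfl, hxy⟩, hy⟩
    adj_iff := fun p q => by
      constructor
      · rintro ⟨hne, x, y, rfl, rfl, hxy⟩
        exact ⟨hne, ((h.adj_iff x y).1 hxy).2⟩
      · rintro ⟨hne, hpq⟩
        obtain ⟨x, rfl⟩ := toQ_surjective p
        obtain ⟨y, rfl⟩ := toQ_surjective q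
        exact ⟨hne, x, y, rfl, rfl, (h.adj_iff x y).2 ⟨fun hxy => hne (by rw [hxy]), hpq⟩⟩
    dist_le := fun p => by
      obtain ⟨x, rfl⟩ := toQ_surjective p
      exact h.dist_le x }

/-- Two smallest parents have the same smallest word, and they are on the same level. -/
theorem RedVert.left_unique (p p' q : S.QVertex) (h : S.RedVert p q) (h' : S.RedVert p' q) :
    p = p' := by
  obtain ⟨x, rfl, hx⟩ := h.2 p' h'.1
  obtain ⟨x', rfl, hx'⟩ := h'.2 _ h.1
  have hw : x.word = x'.word := le_antisymm (hx x' rfl) (hx' x rfl)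
  have hl : x.level = x'.level := by
    have h1 : S.qlevel q = x.level + 1 := QVert.qlevel_eq _ _ h.1
    have h2 : S.qlevel q = x'.level + 1 := QVert.qlevel_eq _ _ h'.1
    omega
  rw [Vertex.ext hl hw]

end IFS

end AugTree

namespace AugTree

/-! ### Dust-like sets -/

theorem exists_pos_forall_le {ι : Type*} [Finite ι] (f : ι → ℝ) (hf : ∀ i, 0 < f i) :
    ∃ δ > 0, ∀ i, δ ≤ f i := by
  rcases isEmpty_or_nonempty ι with h | h
  · exact ⟨1, one_pos, fun i => h.elim i⟩
  · obtain ⟨i, hi⟩ := Finite.exists_min f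
    exact ⟨f i, hf i, hi⟩

theorem exists_split_of_not_prefix {α : Type*} : ∀ l l' : List α, ¬ l <+: l' → ¬ l' <+: l →
    ∃ u i j v v', i ≠ j ∧ l = u ++ i :: v ∧ l' = u ++ j :: v'
  | [], _, h, _ => absurd (List.nil_prefix) h
  | _ :: _, [], _, h => absurd (List.nil_prefix) h
  | a :: l, b :: l', h, h' => by
    by_cases hab : a = b
    · subst hab
      obtain ⟨u, i, j, v, v', hij, rfl, rfl⟩ := exists_split_of_not_prefix l l'
        (fun hp => h (List.prefix_cons_inj a |>.2 hp)) (fun hp => h' (List.prefix_cons_inj a |>.2 hp))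
      exact ⟨a :: u, i, j, v, v', hij, rfl, rfl⟩
    · exact ⟨[], a, b, l, l', hab, rfl, rfl⟩

namespace IFS

variable {d N : ℕ} {ρ : Fin N → ℝ} {S : IFS d ρ} {K : Set (EuclideanSpace ℝ (Fin d))}

/-- The pieces of a dust-like set are separated at all levels. -/
theorem IsDustLike.exists_hor_eq_bot (hK : S.IsSelfSimilarSet K) (hS : S.IsDustLike K)
    (hρ : ∀ i, 0 < ρ i ∧ ρ i < 1) : ∃ κ > 0, S.hor K κ = ⊥ := by
  have hc : ∀ i, IsCompact (S.map i '' K) := fun i => hK.isCompact_image [i]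
  obtain ⟨δ, hδ, hle⟩ := exists_pos_forall_le
    (fun p : {p : Fin N × Fin N // p.1 ≠ p.2} => setDist (S.map p.1.1 '' K) (S.map p.1.2 '' K))
    fun p => by
      by_contra! h
      obtain ⟨a, ha, b, hb, hab⟩ := (setDist_le_iff (hc _) (hc _) (hK.nonempty.image _)
        (hK.nonempty.image _)).1 h
      exact (hS p.2).le_bot ⟨ha, dist_le_zero.1 hab ▸ hb⟩
  refine ⟨δ, hδ, ?_⟩
  ext x y
  rw [hK.hor_adj_iff, SimpleGraph.bot_adj, iff_false]
  rintro ⟨hne, hl, a, ha, b, hb, hab⟩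
  -- Different words of one level are not prefixes of each other. Stripping the common prefix `u`
  -- leads to two first-level pieces, at distance at least `δ`, and the ratio of `u` exceeds the
  -- power of `r` for this level.
  obtain ⟨u, i, j, v, v', hij, hx, hy⟩ := exists_split_of_not_prefix x.word y.word
    (fun h => hne (Vertex.ext hl (eq_of_prefix_of_mem_levelWords hρ x.mem (hl ▸ y.mem) h)))
    (fun h => hne (Vertex.ext hl (eq_of_prefix_of_mem_levelWords hρ (hl ▸ y.mem) x.mem h).symm))
  have key : ∀ w k v, w = u ++ k :: v → ∀ a ∈ S.wordMap w '' K,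
      ∃ a' ∈ S.map k '' K, S.wordMap u a' = a := by
    rintro _ k v rfl _ ⟨a, ha, rfl⟩
    rw [wordMap_append]
    exact ⟨S.map k (S.wordMap v a), ⟨_, hK.wordMap_image_subset v ⟨a, ha, rfl⟩, rfl⟩, rfl⟩
  obtain ⟨a', ha', rfl⟩ := key _ _ _ hx a ha
  obtain ⟨b', hb', rfl⟩ := key _ _ _ hy b hb
  have h1 := lt_wordRatio_of_ssubprefix hρ x.mem hx (List.cons_ne_nil _ _)
  have h2 : δ ≤ dist a' b' := (hle ⟨(i, j), hij⟩).trans ((setDist_le_iff (hc _) (hc _)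
    (hK.nonempty.image _) (hK.nonempty.image _)).2 ⟨a', ha', b', hb', le_rfl⟩)
  rw [S.dist_wordMap, mul_comm δ] at hab
  exact absurd hab (not_le.2 ((mul_lt_mul_of_pos_right h1 hδ).trans_le
    (mul_le_mul_of_nonneg_left h2 (wordRatio_pos hρ u).le)))

/-- A dust-like self-similar set is the boundary of the tree of its words. -/
theorem IsDustLike.lipEquiv_boundary (hK : S.IsSelfSimilarSet K) (hS : S.IsDustLike K)
    (hρ : ∀ i, 0 < ρ i ∧ ρ i < 1) (hm : minRatio ρ ∈ Set.Ioo (0 : ℝ) 1) :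
    LipEquiv K (Boundary (Vert (ρ := ρ)) (root ρ) ⟨minRatio ρ, hm⟩) := by
  classical
  have := hK.nonempty_fin
  obtain ⟨κ, hκ, hbot⟩ := IsDustLike.exists_hor_eq_bot hK hS hρ
  have hreach : ∀ x y, (S.hor K κ).Reachable x y → x = y := by
    intro x y h
    rwa [hbot, SimpleGraph.reachable_bot] at h
  -- All components are single vertices, so the ordinary parent already serves as the rearranged
  -- one.
  let q : Vertex ρ → Vertex ρ := fun y =>
    if hy : y.level ≠ 0 then (exists_vert hρ y hy).choose else y
  have hq : ∀ y, y.level ≠ 0 → Vert (q y) y := by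
    intro y hy
    simp only [q, dif_pos hy]
    exact (exists_vert hρ y hy).choose_spec
  have hE : (fun x y : Vertex ρ => y.level ≠ 0 ∧ q y = x) = Vert := by
    funext x y
    refine propext ⟨fun h => h.2 ▸ hq y h.1, fun h => ?_⟩
    have hy : y.level ≠ 0 := by
      rw [h.1]
      exact Nat.succ_ne_zero _
    exact ⟨hy, Vert.left_unique hρ _ _ _ (hq y hy) h⟩
  rw [← hE]
  refine IsPieceSystem.lipEquiv_boundary (s := ⟨minRatio ρ, hm⟩) (hK.isPieceSystem hρ κ) hκ
    Metric.diam_nonneg (M := 1) (fun T => ?_) ⟨fun y y' h => by rw [hreach y y' h],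
      fun y hy => ⟨q y, hq y hy, .rfl⟩⟩
  induction T using SimpleGraph.ConnectedComponent.ind with | _ x
  have : Subsingleton ((S.hor K κ).connectedComponentMk x).supp := ⟨fun y z => Subtype.ext
    ((hreach _ _ (SimpleGraph.ConnectedComponent.exact y.2)).trans
      (hreach _ _ (SimpleGraph.ConnectedComponent.exact z.2)).symm)⟩
  exact Finite.card_le_one_iff_subsingleton.2 this

/-- Maps of a nonempty compact set into itself have a self-similar set. -/
theorem exists_isSelfSimilarSet [Nonempty (Fin N)] (S : IFS d ρ) (hρ : ∀ i, 0 < ρ i)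
    {Q : Set (EuclideanSpace ℝ (Fin d))} (hQ : IsCompact Q) (hQ0 : Q.Nonempty)
    (hSQ : ∀ i, Set.MapsTo (S.map i) Q Q) : ∃ K ⊆ Q, S.IsSelfSimilarSet K := by
  have hcont : ∀ i, Continuous (S.map i) := fun i => S.continuous_wordMap [i]
  have hinj : ∀ i, Function.Injective (S.map i) := by
    intro i x y hxy
    have h := S.dist_map i x y
    rw [hxy, dist_self] at h
    exact dist_eq_zero.1 ((mul_eq_zero.1 h.symm).resolve_left (hρ i).ne')
  let W : ℕ → Set (EuclideanSpace ℝ (Fin d)) :=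
    fun k => Nat.rec Q (fun _ A => ⋃ i, S.map i '' A) k
  have hsucc : ∀ k, W (k + 1) = ⋃ i, S.map i '' W k := fun _ => rfl
  have hanti : ∀ k, W (k + 1) ⊆ W k := by
    intro k
    induction k with
    | zero => exact Set.iUnion_subset fun i => (hSQ i).image_subset
    | succ k ih =>
      rw [hsucc k, hsucc (k + 1)]
      exact Set.iUnion_mono fun i => Set.image_mono ih
  have hcomp : ∀ k, IsCompact (W k) := by
    intro k
    induction k with
    | zero => exact hQ
    | succ k ih => exact isCompact_iUnion fun i => ih.image (hcont i)
  have hne : ∀ k, (W k).Nonempty := by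
    intro k
    induction k with
    | zero => exact hQ0
    | succ k ih => exact Set.nonempty_iUnion.2 ⟨Classical.arbitrary _, ih.image _⟩
  refine ⟨⋂ k, W k, Set.iInter_subset W 0, ?_, ?_, ?_⟩
  · exact IsCompact.nonempty_iInter_of_sequence_nonempty_isCompact_isClosed W hanti hne (hcomp 0)
      fun k => (hcomp k).isClosed
  · exact (hcomp 0).of_isClosed_subset (isClosed_iInter fun k => (hcomp k).isClosed)
      (Set.iInter_subset W 0)
  · refine Set.Subset.antisymm (fun a ha => ?_) (Set.iUnion_subset fun i => ?_)
    · rw [Set.mem_iInter] at ha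
      -- One index serves all levels: otherwise, beyond the largest of the finitely many failing
      -- levels, no index would work.
      have hi : ∃ i, ∀ k, a ∈ S.map i '' W k := by
        by_contra! h
        choose k hk using h
        obtain ⟨b, hb⟩ := (Set.finite_range k).bddAbove
        have hab := ha (b + 1)
        rw [hsucc, Set.mem_iUnion] at hab
        obtain ⟨i, hi⟩ := hab
        exact hk i (Set.image_mono (antitone_nat_of_succ_le hanti (hb ⟨i, rfl⟩)) hi)
      obtain ⟨i, hi⟩ := hi
      obtain ⟨b, hb, rfl⟩ := hi 0
      refine Set.mem_iUnion.2 ⟨i, b, Set.mem_iInter.2 fun k => ?_, rfl⟩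
      exact (hinj i).mem_set_image.1 (hi k)
    · rintro _ ⟨a, ha, rfl⟩
      refine Set.mem_iInter.2 fun k => hanti k ?_
      rw [hsucc]
      exact Set.mem_iUnion.2 ⟨i, a, Set.mem_iInter.1 ha k, rfl⟩

end IFS

/-- The similitudes `x ↦ ρ i • (cyclic shift of x) + i • e₀`. -/
noncomputable def shiftIFS {N : ℕ} (ρ : Fin N → ℝ) (hρ : ∀ i, 0 ≤ ρ i) (k : ℕ) :
    IFS (k + 1) ρ where
  map i x := ρ i • LinearIsometryEquiv.piLpCongrLeft 2 ℝ ℝ (finRotate (k + 1)) x +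
    EuclideanSpace.single 0 (i : ℝ)
  dist_map i x y := by
    rw [dist_add_right, dist_smul₀, LinearIsometryEquiv.dist_map, Real.norm_of_nonneg (hρ i)]

theorem shiftIFS_zero {N : ℕ} {ρ : Fin N → ℝ} (hρ : ∀ i, 0 ≤ ρ i) (k : ℕ) (i : Fin N)
    (x : EuclideanSpace ℝ (Fin (k + 1))) :
    (shiftIFS ρ hρ k).map i x 0 = ρ i * x (Fin.last k) + i := by
  have h : (-1 : Fin (k + 1)) = Fin.last k := neg_eq_of_add_eq_zero_left (Fin.last_add_one k)
  simp [shiftIFS, LinearIsometryEquiv.piLpCongrLeft_apply, Equiv.piCongrLeft', h]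

theorem shiftIFS_succ {N : ℕ} {ρ : Fin N → ℝ} (hρ : ∀ i, 0 ≤ ρ i) (k : ℕ) (i : Fin N)
    (x : EuclideanSpace ℝ (Fin (k + 1))) (j : Fin k) :
    (shiftIFS ρ hρ k).map i x j.succ = ρ i * x j.castSucc := by
  have h : j.succ - 1 = j.castSucc := sub_eq_iff_eq_add.2 Fin.coeSucc_eq_succ.symm
  simp [shiftIFS, LinearIsometryEquiv.piLpCongrLeft_apply, Equiv.piCongrLeft', h]

/-- There are dust-like self-similar sets with any given ratios. -/
theorem exists_isDustLike {N : ℕ} [Nonempty (Fin N)] {ρ : Fin N → ℝ}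
    (hρ : ∀ i, 0 < ρ i ∧ ρ i < 1) :
    ∃ (D : ℕ) (F : IFS D ρ) (L : Set (EuclideanSpace ℝ (Fin D))),
      F.IsSelfSimilarSet L ∧ F.IsDustLike L := by
  obtain ⟨c, hc0, hc1, hc⟩ := exists_ratio_bound hρ
  have hN : (1 : ℝ) ≤ N := by exact_mod_cast Fin.pos (Classical.arbitrary (Fin N))
  -- The dimension is taken so large that a coordinate of size `2 * N`, after `k` contractions, is
  -- below `1 / 2`.
  obtain ⟨k, hk⟩ := exists_pow_lt_of_lt_one (show (0 : ℝ) < 1 / (4 * N) by positivity) hc1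
  have hρ0 : ∀ i, 0 ≤ ρ i := fun i => (hρ i).1.le
  -- Coordinate `j` was coordinate 0 and has since been contracted `j` times. It re-enters
  -- coordinate 0 with size below `1 / 2`, where `i` is added.
  let Q : Set (EuclideanSpace ℝ (Fin (k + 1))) := {x | ∀ j, |x j| ≤ 2 * N * c ^ (j : ℕ)}
  have hQ : IsCompact Q := by
    refine Metric.isCompact_of_isClosed_isBounded ?_ ?_
    · have : Q = ⋂ j : Fin (k + 1), {x | |x j| ≤ 2 * N * c ^ (j : ℕ)} := by
        ext x
        simp [Q]
      rw [this]
      exact isClosed_iInter fun j => isClosed_le (by fun_prop) continuous_const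
    · refine isBounded_iff_forall_norm_le.2 ⟨√(∑ j : Fin (k + 1), (2 * N * c ^ (j : ℕ)) ^ 2), ?_⟩
      intro x hx
      rw [EuclideanSpace.norm_eq]
      refine Real.sqrt_le_sqrt (Finset.sum_le_sum fun j _ => ?_)
      exact pow_le_pow_left₀ (norm_nonneg _) (hx j) 2
  have hlast : ∀ x ∈ Q, ∀ i, |ρ i * x (Fin.last k)| < 1 / 2 := by
    intro x hx i
    have h1 : |x (Fin.last k)| ≤ 2 * N * c ^ k := by simpa using hx (Fin.last k)
    rw [abs_mul, abs_of_nonneg (hρ0 i)]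
    have h2 : 2 * N * c ^ k < 1 / 2 := by
      rw [lt_div_iff₀ (by positivity)] at hk
      linarith
    have h3 := mul_le_of_le_one_left (abs_nonneg (x (Fin.last k))) (hρ i).2.le
    linarith
  have hSQ : ∀ i, Set.MapsTo ((shiftIFS ρ hρ0 k).map i) Q Q := by
    intro i x hx j
    refine Fin.cases ?_ (fun j => ?_) j
    · rw [shiftIFS_zero, Fin.val_zero, pow_zero, mul_one]
      have h1 := hlast x hx i
      have h2 : ((i : ℕ) : ℝ) + 1 ≤ N := by exact_mod_cast i.2
      have h3 : (0 : ℝ) ≤ (i : ℕ) := Nat.cast_nonneg _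
      have h4 := abs_add_le (ρ i * x (Fin.last k)) ((i : ℕ) : ℝ)
      rw [abs_of_nonneg h3] at h4
      linarith
    · rw [shiftIFS_succ, abs_mul, abs_of_nonneg (hρ0 i), Fin.val_succ, pow_succ]
      have h1 : |x j.castSucc| ≤ 2 * N * c ^ (j : ℕ) := by simpa using hx j.castSucc
      have h2 := mul_le_mul (hc i) h1 (abs_nonneg _) hc0.le
      linarith
  obtain ⟨L, hLQ, hL⟩ := (shiftIFS ρ hρ0 k).exists_isSelfSimilarSet (fun i => (hρ i).1) hQ
    ⟨0, fun j => by simp only [PiLp.zero_apply, abs_zero]; positivity⟩ hSQ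
  refine ⟨k + 1, shiftIFS ρ hρ0 k, L, hL, fun i j hij => Set.disjoint_left.2 ?_⟩
  rintro _ ⟨x, hx, rfl⟩ ⟨y, hy, hxy⟩
  -- On the `i`-th piece the coordinate 0 lies within `1 / 2` of `i`, which separates the pieces.
  have h0 := congrArg (fun z : EuclideanSpace ℝ (Fin (k + 1)) => z 0) hxy
  simp only [shiftIFS_zero] at h0
  have h1 := abs_lt.1 (hlast x (hLQ hx) i)
  have h2 := abs_lt.1 (hlast y (hLQ hy) j)
  have h3 : ((i : ℕ) : ℝ) < (j : ℕ) + 1 := by linarith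
  have h4 : ((j : ℕ) : ℝ) < (i : ℕ) + 1 := by linarith
  have h5 : (i : ℕ) < j + 1 := by exact_mod_cast h3
  have h6 : (j : ℕ) < i + 1 := by exact_mod_cast h4
  exact hij (Fin.ext (by omega))

end AugTree

namespace AugTree

/-! ### Lipschitz equivalence of self-similar sets -/

/-- The size of a component depends only on its class, which bounds the sizes of all components at
once. -/
theorem IsRepresentation.card_supp {V : Type*} {H : SimpleGraph V} {m n : ℕ}
    {cls : H.ConnectedComponent → Fin m} {typ : V → Fin n} {u : Matrix (Fin m) (Fin n) ℕ}
    (h : IsRepresentation H cls typ u) (T : H.ConnectedComponent) [Finite T.supp] :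
    Nat.card T.supp = ∑ j, u (cls T) j := by
  rw [← Nat.card_congr (Equiv.sigmaFiberEquiv fun x : T.supp => typ x.1), Nat.card_sigma]
  exact Finset.sum_congr rfl fun j _ => (card_fiber_subtype _ typ j).trans (h T j)

/-- If the graph is simple and its incidence matrix is rearrangeable, then the space is the
boundary of a typed tree whose incidence matrix is `B`. -/
theorem IsPieceSystem.exists_tree {V Z : Type*} [MetricSpace Z] {vert : V → V → Prop}
    {H : SimpleGraph V} {lev : V → ℕ} {root : V} {piece : V → Set Z} {s : Set.Ioo (0 : ℝ) 1}
    {κ D : ℝ} (h : IsPieceSystem vert H lev root piece s κ D) (hκ : 0 < κ) (hD : 0 ≤ D)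
    {tree : V → V → Prop} (hlev : ∀ x y, tree x y → lev y = lev x + 1)
    (huniq : ∀ x x' y, tree x y → tree x' y → x = x') {n : ℕ} [NeZero n]
    {B : Matrix (Fin n) (Fin n) ℕ} (hB : IsSimpleRearrangeable vert H tree root B) :
    ∃ (E : V → V → Prop) (typ : V → Fin n), LipEquiv Z (Boundary E root s) ∧
      (∀ x, Finite {y // E x y}) ∧ (∀ x j, Nat.card {y // E x y ∧ typ y = j} = B (typ x) j) ∧
      typ root = 0 := by
  obtain ⟨m, A, u, cls, typ, hA, htree, hrep, hre⟩ := hB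
  have hL := h.isLeveled hκ
  have hinj : Function.Injective B := fun i j => htree.injective hlev huniq fun x =>
    (h.finite_lev (lev x + 1)).subset fun y hy => hlev x y hy
  obtain ⟨q, hq, hcard⟩ := exists_rearrangedParent hL hA.card_eq hrep hre hinj
  refine ⟨_, typ, h.lipEquiv_boundary hκ hD (M := ∑ i, ∑ j, u i j) (fun T => ?_) hq,
    fun x => (h.finite_lev (lev x + 1)).subset ?_, hcard, htree.root_eq⟩
  · have := hL.finite_supp T
    rw [hrep.card_supp]
    exact Finset.single_le_sum (f := fun i => ∑ j, u i j) (fun _ _ => Nat.zero_le _)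
      (Finset.mem_univ _)
  · rintro y ⟨hy, rfl⟩
    obtain ⟨x, hx, hxq⟩ := hq.exists_vert y hy
    change lev y = lev (q y) + 1
    rw [h.vert_lev _ _ hx, hL.lev_eq_of_reachable hxq]

namespace IFS

variable {d N n : ℕ} [NeZero n] {ρ : Fin N → ℝ} {S : IFS d ρ}
  {K : Set (EuclideanSpace ℝ (Fin d))} {κ : ℝ} {B : Matrix (Fin n) (Fin n) ℕ}

theorem AugmentedHyp.exists_tree (h : S.AugmentedHyp K κ B) (hK : S.IsSelfSimilarSet K)
    (hρ : ∀ i, 0 < ρ i ∧ ρ i < 1) (hκ : 0 < κ) (hm : minRatio ρ ∈ Set.Ioo (0 : ℝ) 1) :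
    ∃ (E : Vertex ρ → Vertex ρ → Prop) (typ : Vertex ρ → Fin n),
      LipEquiv K (Boundary E (root ρ) ⟨minRatio ρ, hm⟩) ∧ (∀ x, Finite {y // E x y}) ∧
      (∀ x j, Nat.card {y // E x y ∧ typ y = j} = B (typ x) j) ∧ typ (root ρ) = 0 :=
  IsPieceSystem.exists_tree (s := ⟨minRatio ρ, hm⟩) (hK.isPieceSystem hρ κ) hκ Metric.diam_nonneg
    Vert.level_eq (Vert.left_unique hρ) h

theorem QuotientHyp.exists_tree (h : S.QuotientHyp K κ B) (hK : S.IsSelfSimilarSet K)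
    (hρ : ∀ i, 0 < ρ i ∧ ρ i < 1) (hκ : 0 < κ) (hm : minRatio ρ ∈ Set.Ioo (0 : ℝ) 1) :
    ∃ (E : S.QVertex → S.QVertex → Prop) (typ : S.QVertex → Fin n),
      LipEquiv K (Boundary E (S.toQ (root ρ)) ⟨minRatio ρ, hm⟩) ∧ (∀ x, Finite {y // E x y}) ∧
      (∀ x j, Nat.card {y // E x y ∧ typ y = j} = B (typ x) j) ∧ typ (S.toQ (root ρ)) = 0 :=
  IsPieceSystem.exists_tree (s := ⟨minRatio ρ, hm⟩) (hK.isPieceSystem_quotient hρ κ) hκ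
    Metric.diam_nonneg (fun p q hpq => QVert.qlevel_eq p q hpq.1) RedVert.left_unique h

/-- Under the hypothesis on the augmented tree, the set is equivalent to all dust-like sets with
the same ratios. -/
theorem AugmentedHyp.lipEquiv_dustLike (h : S.AugmentedHyp K κ B) (hK : S.IsSelfSimilarSet K)
    (hρ : ∀ i, 0 < ρ i ∧ ρ i < 1) (hκ : 0 < κ) {D : ℕ} {F : IFS D ρ}
    {L : Set (EuclideanSpace ℝ (Fin D))} (hL : F.IsSelfSimilarSet L) (hF : F.IsDustLike L) :
    LipEquiv K L := by
  have := hK.nonempty_fin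
  have hm := minRatio_mem_Ioo hρ
  obtain ⟨E, typ, hE, hfin, hB, hroot⟩ := h.exists_tree hK hρ hκ hm
  obtain ⟨_, _, _, _, typ', -, htree, -, -⟩ := h
  refine (hE.trans (lipEquiv_boundary_of_incidence (B := B) hfin (fun x => ?_) hB htree.card_eq
    (hroot.trans htree.root_eq.symm))).trans (IsDustLike.lipEquiv_boundary hL hF hρ hm).symm
  exact (finite_level hρ (x.level + 1)).subset fun y hy => Vert.level_eq x y hy

/-- A self-similar set with two points has no isolated points. -/
theorem IsSelfSimilarSet.exists_ne_dist_lt (hK : S.IsSelfSimilarSet K)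
    (hρ : ∀ i, 0 < ρ i ∧ ρ i < 1) [Nontrivial K] (a : K) {ε : ℝ} (hε : 0 < ε) :
    ∃ b : K, b ≠ a ∧ dist b a < ε := by
  have := hK.nonempty_fin
  have hm := minRatio_mem_Ioo hρ
  have h0 : Filter.Tendsto (fun k : ℕ => Metric.diam K * minRatio ρ ^ k) Filter.atTop
      (nhds (Metric.diam K * 0)) :=
    (tendsto_pow_atTop_nhds_zero_of_lt_one hm.1.le hm.2).const_mul _
  rw [mul_zero] at h0
  obtain ⟨k, hk⟩ := (h0.eventually (gt_mem_nhds hε)).exists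
  obtain ⟨x, hx, ha⟩ := IsPieceSystem.exists_mem (s := ⟨minRatio ρ, hm⟩)
    (hK.isPieceSystem hρ 1) a k
  -- The small piece around `a` contains the distinct images of two points of `K`, and at least one
  -- of them is not `a`.
  obtain ⟨p, q, hpq⟩ := exists_pair_ne K
  have hne : S.wordMap x.word p ≠ S.wordMap x.word q := by
    rw [← dist_pos, S.dist_wordMap]
    exact mul_pos (wordRatio_pos hρ _) (dist_pos.2 fun h => hpq (Subtype.ext h))
  have hb : ∃ c ∈ S.wordMap x.word '' K, c ≠ a.1 := by
    by_cases hp : S.wordMap x.word p = a.1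
    · exact ⟨_, ⟨q.1, q.2, rfl⟩, fun hq => hne (hp.trans hq.symm)⟩
    · exact ⟨_, ⟨p.1, p.2, rfl⟩, hp⟩
  obtain ⟨c, hc, hca⟩ := hb
  refine ⟨⟨c, hK.wordMap_image_subset _ hc⟩, fun h => hca (congrArg Subtype.val h), ?_⟩
  have := hK.dist_le hρ x hc ha
  rw [hx] at this
  exact this.trans_lt hk

/-- An ultrametric space which is Lipschitz equivalent to a self-similar set is of Cantor type. -/
theorem IsSelfSimilarSet.isCantorType (hK : S.IsSelfSimilarSet K)
    (hρ : ∀ i, 0 < ρ i ∧ ρ i < 1) {C : Type*} [MetricSpace C] [IsUltrametricDist C]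
    (h : LipEquiv K C) : IsCantorType C := by
  obtain ⟨f, c, hc, hf⟩ := h
  have hcont : Continuous f := (LipschitzWith.of_dist_le_mul (K := ⟨c, hc.le⟩)
    fun x y => (hf x y).2).continuous
  have : CompactSpace K := isCompact_iff_compactSpace.1 hK.isCompact
  -- Compactness is carried over by `f`, whereas total disconnectedness holds in any ultrametric
  -- space.
  refine ⟨⟨f ⟨_, hK.nonempty.some_mem⟩⟩, f.surjective.compactSpace hcont, inferInstance,
    fun hC => ?_⟩
  have : Nontrivial K := f.nontrivial
  rw [perfectSpace_iff_forall_not_isolated]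
  intro x
  rw [Metric.nhdsWithin_basis_ball.neBot_iff]
  intro ε hε
  obtain ⟨b, hb, hlt⟩ := hK.exists_ne_dist_lt hρ (f.symm x) (div_pos hε hc)
  refine ⟨f b, ?_, fun h => hb (by rw [← h, Equiv.symm_apply_apply])⟩
  have h2 := (hf b (f.symm x)).2
  rw [Equiv.apply_symm_apply] at h2
  rw [lt_div_iff₀ hc, mul_comm] at hlt
  exact Metric.mem_ball.2 (h2.trans_lt hlt)

end IFS

end AugTree


theorem theorem1p3 {d d' N n : ℕ} [NeZero n]
    -- two systems of similitudes with the same ratios, and their self-similar sets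
    (ρ : Fin N → ℝ) (hρ : ∀ i, 0 < ρ i ∧ ρ i < 1)
    (S : AugTree.IFS d ρ) (S' : AugTree.IFS d' ρ)
    (K : Set (EuclideanSpace ℝ (Fin d))) (K' : Set (EuclideanSpace ℝ (Fin d')))
    (hK : S.IsSelfSimilarSet K) (hK' : S'.IsSelfSimilarSet K')
    -- the constants of the horizontal edges, and the common incidence matrix of the trees
    (κ κ' : ℝ) (hκ : 0 < κ) (hκ' : 0 < κ')
    (B : Matrix (Fin n) (Fin n) ℕ) :
    (S.AugmentedHyp K κ B → S'.AugmentedHyp K' κ' B →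
      AugTree.LipEquiv K K' ∧
      (∃ (D : ℕ) (F : AugTree.IFS D ρ) (L : Set (EuclideanSpace ℝ (Fin D))),
        F.IsSelfSimilarSet L ∧ F.IsDustLike L ∧
          AugTree.LipEquiv K L ∧ AugTree.LipEquiv K' L) ∧
      (∀ (D : ℕ) (F : AugTree.IFS D ρ) (L : Set (EuclideanSpace ℝ (Fin D))),
        F.IsSelfSimilarSet L → F.IsDustLike L →
          AugTree.LipEquiv K L ∧ AugTree.LipEquiv K' L)) ∧
    (S.QuotientHyp K κ B → S'.QuotientHyp K' κ' B →
      AugTree.LipEquiv K K' ∧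
      ∃ (C : Type) (_ : MetricSpace C), IsUltrametricDist C ∧ AugTree.IsCantorType C ∧
        AugTree.LipEquiv K C ∧ AugTree.LipEquiv K' C) := by
  have hN := hK.nonempty_fin
  have hm := AugTree.minRatio_mem_Ioo hρ
  refine ⟨fun h h' => ?_, fun h h' => ?_⟩
  · obtain ⟨D, F, L, hL, hF⟩ := AugTree.exists_isDustLike hρ
    have hKL := h.lipEquiv_dustLike hK hρ hκ hL hF
    have hKL' := h'.lipEquiv_dustLike hK' hρ hκ' hL hF
    exact ⟨hKL.trans hKL'.symm, ⟨D, F, L, hL, hF, hKL, hKL'⟩, fun D F L hL hF =>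
      ⟨h.lipEquiv_dustLike hK hρ hκ hL hF, h'.lipEquiv_dustLike hK' hρ hκ' hL hF⟩⟩
  · obtain ⟨E, typ, hE, hfin, hB, hroot⟩ := h.exists_tree hK hρ hκ hm
    obtain ⟨E', typ', hE', hfin', hB', hroot'⟩ := h'.exists_tree hK' hρ hκ' hm
    have hEE' := AugTree.lipEquiv_boundary_of_incidence (B := B) (s := ⟨AugTree.minRatio ρ, hm⟩)
      hfin hfin' hB hB' (hroot.trans hroot'.symm)
    have hK'E := hE'.trans hEE'.symm
    exact ⟨hE.trans hK'E.symm, AugTree.Boundary E (S.toQ (AugTree.root ρ)) ⟨_, hm⟩,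
      inferInstance, inferInstance, hK.isCantorType hρ hE, hE, hK'E⟩
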